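/- Let $k$ be a field with $\mathrm{char}(k)\neq 2$. Let $D_\infty=\mathbb Z_2*\mathbb Z_2=\langle g_0,g_1\mid g_0^2=1=g_1^2\rangle$, with the action of $\mathbb Z_2=\langle h\rangle$ by automorphisms given by $h.g_0=g_1$, $h.g_1=g_0$. For a finite group $H$ acting by automorphisms on a group $\Gamma$, the smash coproduct $k[\Gamma]\rtimes k^H$ is the Hopf algebra equal to $k[\Gamma]\otimes k^H$ as an algebra, with (writing $r\#\delta_h=r\otimes\delta_h$, $r\in\Gamma$, $h\in H$) $$\Delta(r\#\delta_h)=\sum_{l\in H}r\#\delta_{l^{-1}}\otimes l.r\#\delta_{lh},\quad \varepsilon(r\#\delta_h)=\delta_{h,1},\quad S(r\#\delta_h)=h^{-1}.r^{-1}\#\delta_{h^{-1}}.$$ If $N\subset\Gamma$ is a normal $H$-stable subgroup and $\Phi:N\to(k^H)^\times$ is a group morphism with $\Phi(r)(lh)=\Phi(l^{-1}.r)(h)\Phi(r)(l)$ and $\Phi(srs^{-1})=\Phi(r)$ for all $r\in N$, $s\in\Gamma$, $h,l\in H$, then $k[\Gamma/N]\rtimes_\Phi k^H$ is the vector space $k[\Gamma/N]\otimes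 k^H$ with unit $1\#1$, counit $\varepsilon(x\#\delta_h)=\delta_{h,1}$ and, for $x,y\in\Gamma/N$ and $h,g\in H$, $$(x\#\delta_h)(y\#\delta_g)=xy\#\delta_h\delta_g\,\Phi(j(x)j(y)j(xy)^{-1}),$$ $$\Delta(x\#\delta_h)=\sum_{l\in H}x\#\delta_{l^{-1}}\otimes l.x\#\delta_{lh}\,\Phi\big((l.j(x))\,j(l.x)^{-1}\big),$$ $$S(x\#\delta_h)=h^{-1}.x^{-1}\#\Phi\big(j(h^{-1}.x^{-1})^{-1}\,(h^{-1}.j(x)^{-1})\big)\delta_{h^{-1}},$$ where $j:\Gamma/N\to\Gamma$ is a section of the projection with $j(1)=1$ (these formulas define a Hopf algebra, which up to isomorphism does not depend on $j$). For $m\ge 1$ let $D_m$ be the dihedral group of order $2m$, let $N_m=\langle (g_0g_1)^m\rangle\subset D_\infty$ (a normal, $\mathbb Z_2$-stable, infinite cyclic subgroup), and let $\Phi_m:N_m\to(k^{\mathbb Z_2})^\times$ be the group morphism sending $(g_0g_1)^m$ to the non-trivial character $\chi:\mathbb Z_2\to\{\pm1\}$. Put $$A(m)=k[D_\infty/N_m]\rtimes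 k^{\mathbb Z_2},\qquad B(m)=k[D_\infty/N_m]\rtimes_{\Phi_m}k^{\mathbb Z_2}.$$ A non-trivial Hopf algebra quotient of a Hopf algebra $A$ is a Hopf algebra $L$ with $\dim L>1$ for which there is a surjective, non-injective Hopf algebra map $A\to L$. **Proposition.** Up to isomorphism, the non-trivial Hopf algebra quotients of $k[D_\infty]\rtimes k^{\mathbb Z_2}$ are exactly the following Hopf algebras: 1. the group algebras $k[D_m]$, $m\geq 1$, and $k[D_\infty]$; 2. $A(m)$, $m\ge1$; 3. $B(m)$, $m\ge1$. Moreover $A(m)\simeq k[D_m]\rtimes k^{\mathbb Z_2}$ for every $m\ge 1$, where $\mathbb Z_2$ acts on $D_m$ by exchanging the two generating reflections (the images of $g_0$ and $g_1$). Consequently, up to isomorphism, the only non-trivial infinite-dimensional Hopf algebra quotient of $k[D_\infty]\rtimes k^{\mathbb Z_2}$ is $k[D_\infty]=k[\mathbb Z_2*\mathbb Z_2]$. -/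

import Mathlib

open scoped TensorProduct

noncomputable section

/-! ## Crossed coproducts

A group `H` (later: finite) acts by automorphisms on a group `Q`.  We build Hopf algebra structures
on the vector space `k[Q] ⊗ k^H`, with basis `x # δ_h` (`x ∈ Q`, `h ∈ H`), of the following form:

* `(x # δ_h) (y # δ_g) = x y # δ_h δ_g σ(x, y)`, with unit `1 # 1 = ∑ h, 1 # δ_h`;
* `Δ (x # δ_h) = ∑ l, (x # δ_{l⁻¹}) ⊗ (l • x # δ_{l h} τ(l, x))`, `ε (x # δ_h) = δ_{h, 1}`;
* `S (x # δ_h) = (h⁻¹ • x⁻¹) # s(x, h) δ_{h⁻¹}`.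

Here `σ(x, y), τ(l, x), s(x, h)` are functions on `H`, and a function `f` times `δ_h` is
`f(h) δ_h`; thus only the values `τ(l, x)(l h)` and the scalar `s(x, h) = s(x, h)(h⁻¹)` matter.
The smash coproduct `k[Q] ⋊ k^H` is the case `σ = τ = s = 1`, and the twisted version
`k[Γ/N] ⋊_Φ k^H` is obtained below from a quotient datum; in both cases the laws are proved. -/

/-- The coefficients in the formulas above, with the identities that make them define a
Hopf algebra. -/
structure CocycleDatum (k Q H : Type*) [Field k] [Group Q] [Group H]
    [MulDistribMulAction H Q] where
  σ : Q → Q → H → k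
  τ : H → Q → H → k
  s : Q → H → k
  σ_one_left : ∀ x h, σ 1 x h = 1
  σ_one_right : ∀ x h, σ x 1 h = 1
  σ_assoc : ∀ x y z h, σ x y h * σ (x * y) z h = σ y z h * σ x (y * z) h
  σ_counit : ∀ x y, σ x y 1 = 1
  τ_one_elt : ∀ l h, τ l 1 h = 1
  τ_one_left : ∀ x h, τ 1 x h = 1
  τ_counit : ∀ l x, τ l x 1 = 1
  τ_coassoc : ∀ q m x g,
    τ (q * m) x (q * g) * τ m x q⁻¹ = τ m x g * τ q (m • x) (q * g)
  τ_mul : ∀ l x y h, σ x y h * τ l (x * y) (l * h) =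
    τ l x (l * h) * τ l y (l * h) * σ x y l⁻¹ * σ (l • x) (l • y) (l * h)
  s_left : ∀ l x, τ l x l * s x l⁻¹ * σ (l • x⁻¹) (l • x) l = 1
  s_right : ∀ l x, τ l x l * s (l • x) l * σ x x⁻¹ l⁻¹ = 1

/-- The vector space `k[Q] ⊗ k^H`, as the free vector space on the set of symbols `x # δ_h`. -/
def Crossed {k Q H : Type*} [Field k] [Group Q] [Group H] [MulDistribMulAction H Q]
    (_D : CocycleDatum k Q H) : Type _ :=
  (Q × H) →₀ k

namespace Crossed

variable {k Q H : Type*} [Field k] [Group Q] [Group H] [MulDistribMulAction H Q]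
variable {D : CocycleDatum k Q H}

instance : AddCommGroup (Crossed D) := inferInstanceAs (AddCommGroup ((Q × H) →₀ k))

instance : Module k (Crossed D) := inferInstanceAs (Module k ((Q × H) →₀ k))

/-- The basis vector `x # δ_h`. -/
def of (D : CocycleDatum k Q H) (x : Q) (h : H) : Crossed D :=
  (Finsupp.single (x, h) 1 : (Q × H) →₀ k)

/-- The linear map with prescribed values on the basis. -/
def lin {V : Type*} [AddCommGroup V] [Module k V] (D : CocycleDatum k Q H) (f : Q → H → V) :
    Crossed D →ₗ[k] V :=
  Finsupp.linearCombination k (fun p : Q × H => f p.1 p.2)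

@[simp] theorem lin_of {V : Type*} [AddCommGroup V] [Module k V] (f : Q → H → V) (x : Q) (h : H) :
    lin D f (of D x h) = f x h := by
  unfold lin of
  exact (Finsupp.linearCombination_single k 1 (x, h)).trans (one_smul _ _)

theorem hom_ext {V : Type*} [AddCommGroup V] [Module k V] {f g : Crossed D →ₗ[k] V}
    (hfg : ∀ x h, f (of D x h) = g (of D x h)) : f = g := by
  refine Finsupp.lhom_ext' (M := k) (R := k) (α := Q × H) (φ := f) (ψ := g) fun p => ?_
  refine LinearMap.ext_ring ?_
  exact hfg p.1 p.2

theorem hom_ext₂ {V : Type*} [AddCommGroup V] [Module k V]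
    {f g : Crossed D →ₗ[k] Crossed D →ₗ[k] V}
    (hfg : ∀ x h y i, f (of D x h) (of D y i) = g (of D x h) (of D y i)) : f = g :=
  hom_ext fun x h => hom_ext fun y i => hfg x h y i


instance [Fintype H] : One (Crossed D) := ⟨∑ h : H, of D 1 h⟩

theorem one_def [Fintype H] : (1 : Crossed D) = ∑ h : H, of D 1 h := rfl

variable [DecidableEq H]

/-- The multiplication, as a bilinear map. -/
def mulLin (D : CocycleDatum k Q H) : Crossed D →ₗ[k] Crossed D →ₗ[k] Crossed D :=
  lin D fun x h => lin D fun y g => if h = g then D.σ x y h • of D (x * y) h else 0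

instance : Mul (Crossed D) := ⟨fun a b => mulLin D a b⟩

theorem mul_def (a b : Crossed D) : a * b = mulLin D a b := rfl

/-- The product formula on the basis. -/
theorem of_mul_of (x y : Q) (h g : H) :
    of D x h * of D y g = if h = g then D.σ x y h • of D (x * y) h else 0 := by
  simp [mul_def, mulLin]

theorem mul_assoc_aux (a b c : Crossed D) : a * b * c = a * (b * c) := by
  have h3 : ∀ x h y i, mulLin D (mulLin D (of D x h) (of D y i)) =
      (mulLin D (of D x h)).comp (mulLin D (of D y i)) := by
    intro x h y i
    refine hom_ext fun z j => ?_
    simp only [LinearMap.comp_apply, ← mul_def, of_mul_of]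
    by_cases hh : h = i
    · subst hh
      by_cases hj : h = j
      · subst hj
        simp only [if_true, mul_def, map_smul, LinearMap.smul_apply]
        simp only [← mul_def, of_mul_of, if_true, smul_smul, D.σ_assoc, mul_assoc]
      · simp only [if_true, hj, if_false, mul_def, map_smul, LinearMap.smul_apply, map_zero]
        simp only [← mul_def, of_mul_of, hj, if_false, smul_zero]
    · by_cases hj : i = j
      · subst hj
        simp only [if_true, hh, if_false, mul_def, map_smul, map_zero, LinearMap.zero_apply]
        simp only [← mul_def, of_mul_of, hh, if_false, smul_zero]
      · simp [hh, hj, mul_def]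
  have h2 : ∀ x h, (mulLin D).comp (mulLin D (of D x h)) =
      (LinearMap.llcomp k _ _ _ (mulLin D (of D x h))).comp (mulLin D) :=
    fun x h => hom_ext fun y i => h3 x h y i
  have h0 : ((mulLin D).flip c).comp ((mulLin D).flip b) = (mulLin D).flip (mulLin D b c) :=
    hom_ext fun x h => LinearMap.congr_fun (LinearMap.congr_fun (h2 x h) b) c
  exact LinearMap.congr_fun h0 a

variable [Fintype H]

theorem mulLin_one_left : mulLin D 1 = LinearMap.id := by
  refine hom_ext fun x h => ?_
  simp [one_def, mulLin, D.σ_one_left]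

theorem mulLin_one_right : (mulLin D).flip 1 = LinearMap.id := by
  refine hom_ext fun x h => ?_
  simp [one_def, mulLin, D.σ_one_right]

instance : Ring (Crossed D) where
  __ := (inferInstance : AddCommGroup (Crossed D))
  mul := (· * ·)
  one := 1
  left_distrib a b c := by simp [mul_def]
  right_distrib a b c := by simp [mul_def]
  zero_mul a := by simp [mul_def]
  mul_zero a := by simp [mul_def]
  mul_assoc := mul_assoc_aux
  one_mul a := LinearMap.congr_fun mulLin_one_left a
  mul_one a := LinearMap.congr_fun mulLin_one_right a

instance : Algebra k (Crossed D) :=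
  Algebra.ofModule (fun r a b => by simp [mul_def]) (fun r a b => by simp [mul_def])

/-- The comultiplication. -/
def comulLin (D : CocycleDatum k Q H) : Crossed D →ₗ[k] Crossed D ⊗[k] Crossed D :=
  lin D fun x h => ∑ l : H, of D x l⁻¹ ⊗ₜ[k] (D.τ l x (l * h) • of D (l • x) (l * h))

/-- The counit. -/
def counitLin (D : CocycleDatum k Q H) : Crossed D →ₗ[k] k :=
  lin D fun _ h => if h = 1 then 1 else 0

/-- The antipode. -/
def antipodeLin (D : CocycleDatum k Q H) : Crossed D →ₗ[k] Crossed D :=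
  lin D fun x h => D.s x h • of D (h⁻¹ • x⁻¹) h⁻¹

instance : CoalgebraStruct k (Crossed D) where
  comul := comulLin D
  counit := counitLin D

/-- The coproduct formula on the basis. -/
theorem comul_of (x : Q) (h : H) : CoalgebraStruct.comul (R := k) (of D x h) =
    ∑ l : H, of D x l⁻¹ ⊗ₜ[k] (D.τ l x (l * h) • of D (l • x) (l * h)) :=
  lin_of _ _ _

/-- The counit formula on the basis. -/
theorem counit_of (x : Q) (h : H) :
    CoalgebraStruct.counit (R := k) (of D x h) = if h = 1 then 1 else 0 :=
  lin_of _ _ _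

instance : Coalgebra k (Crossed D) where
  coassoc := by
    refine hom_ext fun x h => ?_
    simp only [LinearMap.comp_apply, comul_of, map_sum, LinearMap.rTensor_tmul,
      LinearMap.lTensor_tmul, TensorProduct.sum_tmul, TensorProduct.tmul_sum, map_smul,
      TensorProduct.tmul_smul, LinearEquiv.coe_coe, TensorProduct.assoc_tmul, Finset.smul_sum,
      ← TensorProduct.smul_tmul', smul_smul]
    rw [Finset.sum_comm]
    refine Finset.sum_congr rfl fun m _ => ?_
    refine Fintype.sum_equiv (Equiv.mulRight m⁻¹) _ _ fun l => ?_
    have key := D.τ_coassoc (l * m⁻¹) m x (m * h)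
    simp only [Equiv.coe_mulRight]
    simp only [mul_inv_rev, inv_inv, mul_assoc, inv_mul_cancel_left, inv_mul_cancel,
      mul_one] at key ⊢
    rw [key]
  rTensor_counit_comp_comul := by
    refine hom_ext fun x h => ?_
    simp only [LinearMap.comp_apply, comul_of, map_sum, LinearMap.rTensor_tmul, counit_of,
      TensorProduct.mk_apply]
    rw [Finset.sum_eq_single 1]
    · simp [D.τ_one_left]
    · intro l _ hl
      simp [hl]
    · simp
  lTensor_counit_comp_comul := by
    refine hom_ext fun x h => ?_
    simp only [LinearMap.comp_apply, comul_of, map_sum, LinearMap.lTensor_tmul, counit_of,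
      TensorProduct.mk_apply, map_smul, LinearMap.flip_apply]
    rw [Finset.sum_eq_single h⁻¹]
    · simp [D.τ_counit]
    · intro l _ hl
      have : l * h ≠ 1 := fun e => hl (eq_inv_of_mul_eq_one_left e)
      simp [this]
    · simp

instance : Bialgebra k (Crossed D) where
  counit_one := by
    simp [one_def, counit_of]
  mul_compr₂_counit := by
    refine hom_ext₂ fun x h y i => ?_
    simp only [LinearMap.compr₂_apply, LinearMap.mul_apply', LinearMap.compl₁₂_apply, of_mul_of,
      counit_of]
    by_cases hh : h = i
    · subst hh
      by_cases h1 : h = 1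
      · subst h1
        simp [counit_of, D.σ_counit]
      · simp [counit_of, h1]
    · by_cases h1 : h = 1
      · have : i ≠ 1 := fun e => hh (h1.trans e.symm)
        simp [hh, this]
      · simp [hh, h1]
  comul_one := by
    simp only [one_def, map_sum, comul_of, smul_one, D.τ_one_elt, one_smul,
      Algebra.TensorProduct.one_def, TensorProduct.sum_tmul, TensorProduct.tmul_sum]
    rw [Finset.sum_comm]
    conv_rhs => rw [Finset.sum_comm]
    refine Fintype.sum_equiv (Equiv.inv H) _ _ fun l => ?_
    exact Fintype.sum_equiv (Equiv.mulLeft l) _ _ fun h => rfl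
  mul_compr₂_comul := by
    refine hom_ext₂ fun x h y i => ?_
    simp only [LinearMap.compr₂_apply, LinearMap.mul_apply', LinearMap.compl₁₂_apply, of_mul_of,
      comul_of, Finset.sum_mul_sum, Algebra.TensorProduct.tmul_mul_tmul, inv_inj,
      smul_mul_assoc, mul_smul_comm]
    by_cases hh : h = i
    · subst hh
      simp only [if_true, map_smul, comul_of, Finset.smul_sum]
      refine Finset.sum_congr rfl fun l _ => ?_
      rw [Finset.sum_eq_single l]
      · simp only [if_true, TensorProduct.tmul_smul, ← TensorProduct.smul_tmul', smul_smul,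
          smul_mul']
        congr 1
        rw [D.τ_mul]
        ring
      · intro m _ hm
        simp [Ne.symm hm]
      · simp
    · simp only [hh, if_false, map_zero]
      symm
      refine Finset.sum_eq_zero fun l _ => Finset.sum_eq_zero fun m _ => ?_
      by_cases hm : l = m
      · subst hm
        simp [hh]
      · simp [hm]

instance : HopfAlgebraStruct k (Crossed D) where
  antipode := antipodeLin D

/-- The antipode formula on the basis. -/
theorem antipode_of (x : Q) (h : H) :
    HopfAlgebraStruct.antipode k (of D x h) = D.s x h • of D (h⁻¹ • x⁻¹) h⁻¹ := by
  change antipodeLin D (of D x h) = _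
  unfold antipodeLin
  rw [lin_of]

instance : HopfAlgebra k (Crossed D) where
  mul_antipode_rTensor_comul := by
    refine hom_ext fun x h => ?_
    simp only [LinearMap.comp_apply, comul_of, map_sum, LinearMap.rTensor_tmul, antipode_of,
      LinearMap.mul'_apply, smul_mul_assoc, mul_smul_comm, of_mul_of, inv_inv, counit_of,
      Algebra.linearMap_apply, Algebra.algebraMap_eq_smul_one, one_def, Finset.smul_sum]
    refine Finset.sum_congr rfl fun l _ => ?_
    by_cases h1 : h = 1
    · subst h1
      have key := D.s_left l x
      rw [mul_assoc] at key
      simp only [mul_one, if_true, smul_smul, one_smul, ← smul_mul', inv_mul_cancel, smul_one]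
      rw [key, one_smul]
    · simp [h1]
  mul_antipode_lTensor_comul := by
    refine hom_ext fun x h => ?_
    simp only [LinearMap.comp_apply, comul_of, map_sum, LinearMap.lTensor_tmul, antipode_of,
      LinearMap.mul'_apply, mul_smul_comm, of_mul_of, map_smul, counit_of,
      Algebra.linearMap_apply, Algebra.algebraMap_eq_smul_one, one_def, Finset.smul_sum]
    refine Fintype.sum_equiv (Equiv.inv H) _ _ fun l => ?_
    by_cases h1 : h = 1
    · subst h1
      have key := D.s_right l x
      rw [mul_assoc] at key
      simp only [mul_one, if_true, smul_smul, one_smul, Equiv.inv_apply]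
      rw [← smul_inv', inv_smul_smul, key, one_smul, mul_inv_cancel]
    · simp [h1]

end Crossed

/-! ## The smash coproduct -/

/-- The data `σ = τ = s = 1`. -/
def CocycleDatum.trivial (k Γ H : Type*) [Field k] [Group Γ] [Group H]
    [MulDistribMulAction H Γ] : CocycleDatum k Γ H where
  σ _ _ _ := 1
  τ _ _ _ := 1
  s _ _ := 1
  σ_one_left _ _ := rfl
  σ_one_right _ _ := rfl
  σ_assoc _ _ _ _ := rfl
  σ_counit _ _ := rfl
  τ_one_elt _ _ := rfl
  τ_one_left _ _ := rfl
  τ_counit _ _ := rfl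
  τ_coassoc _ _ _ _ := rfl
  τ_mul _ _ _ _ := by simp
  s_left _ _ := by simp
  s_right _ _ := by simp

section

variable {k Γ H : Type*} [Field k] [Group Γ] [Group H] [MulDistribMulAction H Γ]

@[simp] theorem CocycleDatum.trivial_σ (x y : Γ) (h : H) : (trivial k Γ H).σ x y h = 1 := rfl
@[simp] theorem CocycleDatum.trivial_τ (l : H) (x : Γ) (h : H) : (trivial k Γ H).τ l x h = 1 := rfl
@[simp] theorem CocycleDatum.trivial_s (x : Γ) (h : H) : (trivial k Γ H).s x h = 1 := rfl

end

/-- The smash coproduct Hopf algebra `k[Γ] ⋊ k^H` of a finite group `H` acting by automorphisms on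
a group `Γ`. -/
abbrev SmashCoproduct (k Γ H : Type*) [Field k] [Group Γ] [Group H]
    [MulDistribMulAction H Γ] : Type _ :=
  Crossed (CocycleDatum.trivial k Γ H)

namespace SmashCoproduct

variable {k Γ H : Type*} [Field k] [Group Γ] [Group H] [MulDistribMulAction H Γ]

/-- The basis element `r # δ_h` of `k[Γ] ⋊ k^H`. -/
abbrev of (k : Type*) {Γ H : Type*} [Field k] [Group Γ] [Group H] [MulDistribMulAction H Γ]
    (r : Γ) (h : H) : SmashCoproduct k Γ H :=
  Crossed.of (CocycleDatum.trivial k Γ H) r h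

variable [DecidableEq H]

/-- `(r # δ_h) (s # δ_g) = r s # δ_h δ_g`. -/
theorem of_mul_of (r s : Γ) (h g : H) :
    of k r h * of k s g = if h = g then of k (r * s) h else 0 := by
  rw [Crossed.of_mul_of]
  simp

variable [Fintype H]

/-- `Δ (r # δ_h) = ∑ l, (r # δ_{l⁻¹}) ⊗ (l • r # δ_{l h})`. -/
theorem comul_of (r : Γ) (h : H) : CoalgebraStruct.comul (R := k) (of k r h) =
    ∑ l : H, of k r l⁻¹ ⊗ₜ[k] of k (l • r) (l * h) := by
  rw [Crossed.comul_of]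
  simp

/-- `S (r # δ_h) = h⁻¹ • r⁻¹ # δ_{h⁻¹}`. -/
theorem antipode_of (r : Γ) (h : H) :
    HopfAlgebraStruct.antipode k (of k r h) = of k (h⁻¹ • r⁻¹) h⁻¹ := by
  rw [Crossed.antipode_of]
  simp

end SmashCoproduct

/-! ## Quotient data and twisted smash coproducts -/

/-- The action of `H` on the quotient of `Γ` by a normal `H`-stable subgroup. -/
@[reducible] def quotientAction {Γ H : Type*} [Group Γ] [Group H] [MulDistribMulAction H Γ]
    (N : Subgroup Γ) [N.Normal] (hN : ∀ (h : H), ∀ r ∈ N, h • r ∈ N) :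
    MulDistribMulAction H (Γ ⧸ N) where
  smul h := QuotientGroup.map N N (MulDistribMulAction.toMonoidHom Γ h) (hN h)
  one_smul x := by
    induction x using QuotientGroup.induction_on with
    | H r => exact congrArg (QuotientGroup.mk (s := N)) (one_smul H r)
  mul_smul h g x := by
    induction x using QuotientGroup.induction_on with
    | H r => exact congrArg (QuotientGroup.mk (s := N)) (mul_smul h g r)
  smul_mul h x y := map_mul (QuotientGroup.map N N (MulDistribMulAction.toMonoidHom Γ h) (hN h)) x y
  smul_one h := map_one (QuotientGroup.map N N (MulDistribMulAction.toMonoidHom Γ h) (hN h))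

/-- A quotient datum for an action of `H` on `Γ` whose first component is the whole acting group:
a normal `H`-stable subgroup `N` of `Γ` and a group morphism `Φ` from `N` to the invertible
elements of `k^H` (the algebra of functions on `H`) with
`Φ(r)(l h) = Φ(l⁻¹ • r)(h) Φ(r)(l)` and `Φ(s r s⁻¹) = Φ(r)`. -/
structure QuotientDatum (k Γ H : Type*) [Field k] [Group Γ] [Group H]
    [MulDistribMulAction H Γ] where
  N : Subgroup Γ
  normal : N.Normal
  stable : ∀ (h : H), ∀ r ∈ N, h • r ∈ N
  Φ : N →* (H → k)ˣ
  Φ_mul : ∀ (r : N) (l h : H), (Φ r : H → k) (l * h) =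
    (Φ ⟨l⁻¹ • (r : Γ), stable l⁻¹ r r.2⟩ : H → k) h * (Φ r : H → k) l
  Φ_conj : ∀ (r : N) (s : Γ), Φ ⟨s * r * s⁻¹, normal.conj_mem r r.2 s⟩ = Φ r

namespace QuotientDatum

variable {k Γ H : Type*} [Field k] [Group Γ] [Group H] [MulDistribMulAction H Γ]
variable (E : QuotientDatum k Γ H)

instance : E.N.Normal := E.normal

instance : MulDistribMulAction H (Γ ⧸ E.N) := quotientAction E.N E.stable

/-- A section `j` of the projection `Γ → Γ/N` with `j 1 = 1`. -/
def j (x : Γ ⧸ E.N) : Γ :=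
  open Classical in if x = 1 then 1 else x.out

@[simp] theorem j_one : E.j 1 = 1 := by simp [j]

@[simp] theorem mk_j (x : Γ ⧸ E.N) : (E.j x : Γ ⧸ E.N) = x := by
  unfold j
  split_ifs with h
  · exact h.symm
  · exact Quotient.out_eq' x

theorem mk_smul (l : H) (r : Γ) : ((l • r : Γ) : Γ ⧸ E.N) = l • (r : Γ ⧸ E.N) := rfl

theorem mem_of_mk {r : Γ} (h : (r : Γ ⧸ E.N) = 1) : r ∈ E.N := (QuotientGroup.eq_one_iff r).1 h

theorem σ_mem (x y : Γ ⧸ E.N) : E.j x * E.j y * (E.j (x * y))⁻¹ ∈ E.N :=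
  E.mem_of_mk (by simp)

theorem τ_mem (l : H) (x : Γ ⧸ E.N) : l • E.j x * (E.j (l • x))⁻¹ ∈ E.N :=
  E.mem_of_mk (by simp [mk_smul])

theorem s_mem (x : Γ ⧸ E.N) (h : H) : (E.j (h⁻¹ • x⁻¹))⁻¹ * h⁻¹ • (E.j x)⁻¹ ∈ E.N :=
  E.mem_of_mk (by simp [mk_smul])

/-- The value of `Φ(r)` at `h`, for `r ∈ N`. -/
def val (r : Γ) (hr : r ∈ E.N) (h : H) : k := (E.Φ ⟨r, hr⟩ : H → k) h

theorem val_congr {r s : Γ} (e : r = s) (hr : r ∈ E.N) (hs : s ∈ E.N) (h : H) :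
    E.val r hr h = E.val s hs h := by subst e; rfl

theorem val_congr_right {h g : H} (e : h = g) {r : Γ} (hr : r ∈ E.N) :
    E.val r hr h = E.val r hr g := by subst e; rfl

theorem val_one {r : Γ} (e : r = 1) (hr : r ∈ E.N) (h : H) : E.val r hr h = 1 := by
  subst e
  have : (⟨1, hr⟩ : E.N) = 1 := rfl
  simp [val, this]

theorem val_mul (r s : Γ) (hr : r ∈ E.N) (hs : s ∈ E.N) (hrs : r * s ∈ E.N) (h : H) :
    E.val (r * s) hrs h = E.val r hr h * E.val s hs h := by
  have : (⟨r * s, hrs⟩ : E.N) = ⟨r, hr⟩ * ⟨s, hs⟩ := rfl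
  unfold val
  rw [this, map_mul]
  rfl

theorem val_ne_zero (r : Γ) (hr : r ∈ E.N) (h : H) : E.val r hr h ≠ 0 := by
  intro h0
  have h1 := E.val_mul r r⁻¹ hr (E.N.inv_mem hr) (by simp) h
  rw [E.val_one (by simp), h0, zero_mul] at h1
  exact one_ne_zero h1

theorem val_conj (s r : Γ) (hr : r ∈ E.N) (hs : s * r * s⁻¹ ∈ E.N) (h : H) :
    E.val (s * r * s⁻¹) hs h = E.val r hr h := by
  unfold val
  rw [E.Φ_conj ⟨r, hr⟩ s]

/-- The cocycle law, in multiplicative form. -/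
theorem val_cocycle (r : Γ) (hr : r ∈ E.N) (q g : H) (hq : q • r ∈ E.N) :
    E.val r hr g = E.val (q • r) hq (q * g) * E.val r hr q⁻¹ := by
  have := E.Φ_mul ⟨r, hr⟩ q⁻¹ (q * g)
  simpa [val] using this

theorem val_at_one (r : Γ) (hr : r ∈ E.N) : E.val r hr 1 = 1 := by
  have h1 := E.val_cocycle r hr 1 1 (E.stable _ _ hr)
  have e := E.val_congr (one_smul H r) (E.stable _ _ hr) hr (1 * 1)
  rw [e] at h1
  simp only [mul_one, inv_one] at h1
  exact (mul_eq_left₀ (E.val_ne_zero r hr 1)).1 h1.symm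

/-- The cocycles attached to a quotient datum:
`σ(x, y) = Φ(j(x) j(y) j(x y)⁻¹)`, `τ(l, x) = Φ((l • j(x)) j(l • x)⁻¹)` and
`s(x, h) = Φ(j(h⁻¹ • x⁻¹)⁻¹ (h⁻¹ • j(x)⁻¹))(h⁻¹)`. -/
def cocycleDatum : CocycleDatum k (Γ ⧸ E.N) H where
  σ x y h := E.val (E.j x * E.j y * (E.j (x * y))⁻¹) (E.σ_mem x y) h
  τ l x h := E.val (l • E.j x * (E.j (l • x))⁻¹) (E.τ_mem l x) h
  s x h := E.val ((E.j (h⁻¹ • x⁻¹))⁻¹ * h⁻¹ • (E.j x)⁻¹) (E.s_mem x h) h⁻¹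
  σ_one_left x h := E.val_one (by simp) _ _
  σ_one_right x h := E.val_one (by simp) _ _
  σ_assoc x y z h := by
    rw [← E.val_conj (E.j x) _ (E.σ_mem y z) (E.normal.conj_mem _ (E.σ_mem y z) _),
      ← E.val_mul _ _ _ _ (E.N.mul_mem (E.σ_mem _ _) (E.σ_mem _ _)),
      ← E.val_mul _ _ _ _ (E.N.mul_mem (E.normal.conj_mem _ (E.σ_mem y z) _) (E.σ_mem _ _))]
    refine E.val_congr ?_ _ _ _
    rw [mul_assoc x y z]
    group
  σ_counit x y := E.val_at_one _ _
  τ_one_elt l h := E.val_one (by simp) _ _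
  τ_one_left x h := E.val_one (by simp) _ _
  τ_counit l x := E.val_at_one _ _
  τ_coassoc q m x g := by
    have hA := E.τ_mem m x
    have hq := E.stable q _ hA
    rw [E.val_cocycle _ hA q g hq]
    have e : E.val ((q * m) • E.j x * (E.j ((q * m) • x))⁻¹) (E.τ_mem (q * m) x) (q * g) =
        E.val (q • (m • E.j x * (E.j (m • x))⁻¹)) hq (q * g) *
          E.val (q • E.j (m • x) * (E.j (q • m • x))⁻¹) (E.τ_mem q (m • x)) (q * g) := by
      rw [← E.val_mul _ _ _ _ (E.N.mul_mem hq (E.τ_mem _ _))]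
      refine E.val_congr ?_ _ _ _
      simp [mul_smul, smul_mul']
    rw [e]
    ring
  τ_mul l x y h := by
    have hS := E.σ_mem x y
    have hl := E.stable l _ hS
    have hB := E.τ_mem l y
    rw [E.val_cocycle _ hS l h hl]
    have e : E.val (l • (E.j x * E.j y * (E.j (x * y))⁻¹)) hl (l * h) *
        E.val (l • E.j (x * y) * (E.j (l • (x * y)))⁻¹) (E.τ_mem l (x * y)) (l * h) =
        E.val (l • E.j x * (E.j (l • x))⁻¹) (E.τ_mem l x) (l * h) *
        E.val (l • E.j y * (E.j (l • y))⁻¹) hB (l * h) *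
        E.val (E.j (l • x) * E.j (l • y) * (E.j (l • x * l • y))⁻¹) (E.σ_mem _ _) (l * h) := by
      rw [← E.val_conj (E.j (l • x)) _ hB (E.normal.conj_mem _ hB _),
        ← E.val_mul _ _ _ _ (E.N.mul_mem hl (E.τ_mem _ _)),
        ← E.val_mul _ _ _ _ (E.N.mul_mem (E.τ_mem _ _) (E.normal.conj_mem _ hB _)),
        ← E.val_mul _ _ _ _ (E.N.mul_mem (E.N.mul_mem (E.τ_mem _ _)
          (E.normal.conj_mem _ hB _)) (E.σ_mem _ _))]
      refine E.val_congr ?_ _ _ _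
      simp only [smul_mul', smul_inv']
      group
    linear_combination E.val _ hS l⁻¹ * e
  s_left l x := by
    have hT := E.τ_mem l x
    have hS := E.s_mem x l⁻¹
    have hM := E.σ_mem (l • x⁻¹) (l • x)
    have hc := E.normal.conj_mem _ hM (E.j (l • x))
    rw [E.val_congr_right (inv_inv l), ← E.val_conj (E.j (l • x)) _ hM hc, mul_right_comm,
      ← E.val_mul _ _ _ _ (E.N.mul_mem hT hc),
      ← E.val_mul _ _ _ _ (E.N.mul_mem (E.N.mul_mem hT hc) hS)]
    refine E.val_one ?_ _ _
    rw [← smul_mul', inv_mul_cancel, smul_one, j_one, inv_inv, smul_inv' l (E.j x)]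
    group
  s_right l x := by
    have hT := E.τ_mem l x
    have hS := E.s_mem (l • x) l
    have hM := E.σ_mem x x⁻¹
    have hU := E.stable l⁻¹ _ hT
    have h1 := E.val_cocycle _ hU l 1 (E.stable l _ hU)
    rw [E.val_at_one, mul_one, E.val_congr (smul_inv_smul l _) _ hT] at h1
    rw [mul_assoc, mul_comm (E.val _ hS _), ← E.val_mul _ _ _ _ (E.N.mul_mem hM hS), h1]
    congr 1
    refine E.val_congr ?_ _ _ _
    rw [mul_inv_cancel, j_one, ← smul_inv', inv_smul_smul, smul_mul', inv_smul_smul]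
    group

/-- The Hopf algebra `k[Γ/N] ⋊_Φ k^H` of a quotient datum `(H, N, Φ)`. -/
abbrev Twisted : Type _ := Crossed E.cocycleDatum

end QuotientDatum


/-! ## The infinite dihedral group and the families of quotients -/

/-- The group `ℤ/2`, written multiplicatively. -/
abbrev C₂ : Type := Multiplicative (ZMod 2)

/-- The generator `h` of `ℤ/2`. -/
def C₂.gen : C₂ := Multiplicative.ofAdd 1

/-- The morphism `ℤ/2 → G` defined by an element of square `1`. -/
def C₂.lift {G : Type*} [Group G] (g : G) (hg : g * g = 1) : C₂ →* G where
  toFun t := if t = 1 then 1 else g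
  map_one' := if_pos rfl
  map_mul' t u := by
    have key : ∀ t u : C₂, (t = 1 ∧ u = 1 ∧ t * u = 1) ∨ (t ≠ 1 ∧ u = 1 ∧ t * u ≠ 1) ∨
        (t = 1 ∧ u ≠ 1 ∧ t * u ≠ 1) ∨ (t ≠ 1 ∧ u ≠ 1 ∧ t * u = 1) := by decide
    rcases key t u with ⟨h1, h2, h3⟩ | ⟨h1, h2, h3⟩ | ⟨h1, h2, h3⟩ | ⟨h1, h2, h3⟩ <;>
      simp [h1, h2, h3, hg]

/-- The action of `ℤ/2` on `Γ` in which the generator acts by the involutive endomorphism `f`. -/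
@[reducible] def involutionAction {Γ : Type*} [Group Γ] (f : Γ →* Γ) (hf : ∀ x, f (f x) = x) :
    MulDistribMulAction C₂ Γ where
  smul t x := if t = 1 then x else f x
  one_smul x := if_pos rfl
  mul_smul t u x := by
    have key : ∀ t u : C₂, (t = 1 ∧ u = 1 ∧ t * u = 1) ∨ (t ≠ 1 ∧ u = 1 ∧ t * u ≠ 1) ∨
        (t = 1 ∧ u ≠ 1 ∧ t * u ≠ 1) ∨ (t ≠ 1 ∧ u ≠ 1 ∧ t * u = 1) := by decide
    change (if t * u = 1 then x else f x) =
      if t = 1 then (if u = 1 then x else f x) else f (if u = 1 then x else f x)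
    rcases key t u with ⟨h1, h2, h3⟩ | ⟨h1, h2, h3⟩ | ⟨h1, h2, h3⟩ | ⟨h1, h2, h3⟩ <;>
      simp [h1, h2, h3, hf]
  smul_mul t x y := by
    change (if t = 1 then x * y else f (x * y)) =
      (if t = 1 then x else f x) * (if t = 1 then y else f y)
    split_ifs <;> simp
  smul_one t := by
    change (if t = 1 then 1 else f 1) = (1 : Γ)
    simp

/-- The infinite dihedral group `D_∞ = ℤ/2 ∗ ℤ/2`, a free product of groups. -/
abbrev DInf : Type := Monoid.Coprod C₂ C₂

namespace DInf

/-- The first generator `g₀`. -/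
def g₀ : DInf := Monoid.Coprod.inl C₂.gen

/-- The second generator `g₁`. -/
def g₁ : DInf := Monoid.Coprod.inr C₂.gen

/-- The action of `ℤ/2` on `ℤ/2 ∗ ℤ/2` whose generator exchanges `g₀` and `g₁`. -/
instance : MulDistribMulAction C₂ DInf :=
  involutionAction (Monoid.Coprod.swap C₂ C₂) Monoid.Coprod.swap_swap

theorem gen_smul_g₀ : C₂.gen • g₀ = g₁ := rfl

theorem gen_smul_g₁ : C₂.gen • g₁ = g₀ := rfl

theorem g₀_mul_self : g₀ * g₀ = 1 := by
  unfold g₀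
  rw [← map_mul, show C₂.gen * C₂.gen = 1 by decide, map_one]

theorem g₁_mul_self : g₁ * g₁ = 1 := by
  unfold g₁
  rw [← map_mul, show C₂.gen * C₂.gen = 1 by decide, map_one]

theorem g₀_inv : g₀⁻¹ = g₀ := inv_eq_of_mul_eq_one_left g₀_mul_self

theorem g₁_inv : g₁⁻¹ = g₁ := inv_eq_of_mul_eq_one_left g₁_mul_self

/-- Every element of `ℤ/2 ∗ ℤ/2` is obtained from `1` by left multiplications by `g₀`, `g₁`. -/
theorem induction {p : DInf → Prop} (h1 : p 1) (h₀ : ∀ x, p x → p (g₀ * x))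
    (h₁ : ∀ x, p x → p (g₁ * x)) (x : DInf) : p x := by
  have key : ∀ t : C₂, t = 1 ∨ t = C₂.gen := by decide
  induction x using Monoid.Coprod.induction_on' with
  | one => exact h1
  | inl_mul t x hx =>
    rcases key t with rfl | rfl
    · simpa using hx
    · exact h₀ x hx
  | inr_mul t x hx =>
    rcases key t with rfl | rfl
    · simpa using hx
    · exact h₁ x hx

/-- The rotation `g₀ g₁`. -/
def rot : DInf := g₀ * g₁

theorem g₀_conj_rot : g₀ * rot * g₀⁻¹ = rot⁻¹ := by
  unfold rot
  rw [mul_inv_rev, g₀_inv, g₁_inv, ← mul_assoc, g₀_mul_self, one_mul]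

theorem g₁_conj_rot : g₁ * rot * g₁⁻¹ = rot⁻¹ := by
  unfold rot
  rw [mul_inv_rev, g₀_inv, g₁_inv, mul_assoc, mul_assoc, g₁_mul_self, mul_one]

/-- The morphism to a dihedral group with `g₀ ↦ s`, `g₁ ↦ s r`, hence `g₀ g₁ ↦ r`. -/
def toDihedral (n : ℕ) : DInf →* DihedralGroup n :=
  Monoid.Coprod.lift (C₂.lift (DihedralGroup.sr 0) (DihedralGroup.sr_mul_self 0))
    (C₂.lift (DihedralGroup.sr 1) (DihedralGroup.sr_mul_self 1))

theorem toDihedral_rot (n : ℕ) : toDihedral n rot = DihedralGroup.r 1 := by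
  have h : (C₂.gen : C₂) ≠ 1 := by decide
  simp [toDihedral, rot, g₀, g₁, C₂.lift, h]

theorem rot_zpow_injective : Function.Injective fun n : ℤ => rot ^ n := by
  intro a b hab
  have h := congrArg (toDihedral 0) hab
  simp only [map_zpow, toDihedral_rot, DihedralGroup.r_one_zpow] at h
  simpa using h

theorem conj_eq (s : DInf) : ∀ z ∈ Subgroup.zpowers rot, s * z * s⁻¹ = z ∨ s * z * s⁻¹ = z⁻¹ := by
  have aux : ∀ g : DInf, g * rot * g⁻¹ = rot⁻¹ → ∀ x : DInf,
      (∀ z ∈ Subgroup.zpowers rot, x * z * x⁻¹ = z ∨ x * z * x⁻¹ = z⁻¹) →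
      ∀ z ∈ Subgroup.zpowers rot, g * x * z * (g * x)⁻¹ = z ∨ g * x * z * (g * x)⁻¹ = z⁻¹ := by
    intro g hg x hx z hz
    have e : g * x * z * (g * x)⁻¹ = g * (x * z * x⁻¹) * g⁻¹ := by group
    have inv : g * z * g⁻¹ = z⁻¹ := by
      obtain ⟨n, rfl⟩ := hz
      change g * rot ^ n * g⁻¹ = (rot ^ n)⁻¹
      rw [← conj_zpow, hg, inv_zpow]
    have inv' : g * z⁻¹ * g⁻¹ = z := by rw [← conj_inv, inv, inv_inv]
    rw [e]
    rcases hx z hz with h | h <;> rw [h]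
    · exact Or.inr inv
    · exact Or.inl inv'
  induction s using DInf.induction with
  | h1 => intro z _; simp
  | h₀ x hx => exact aux g₀ g₀_conj_rot x hx
  | h₁ x hx => exact aux g₁ g₁_conj_rot x hx

theorem smul_eq (t : C₂) : ∀ z ∈ Subgroup.zpowers rot, t • z = z ∨ t • z = z⁻¹ := by
  have key : ∀ t : C₂, t = 1 ∨ t = C₂.gen := by decide
  have hr : C₂.gen • rot = rot⁻¹ := by
    unfold rot
    rw [smul_mul', gen_smul_g₀, gen_smul_g₁, mul_inv_rev, g₀_inv, g₁_inv]
  rintro z ⟨n, rfl⟩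
  rcases key t with rfl | rfl
  · exact Or.inl (one_smul _ _)
  · right
    change C₂.gen • rot ^ n = (rot ^ n)⁻¹
    rw [smul_zpow', hr, inv_zpow]

/-- The subgroup `N_m = ⟨(g₀ g₁)^m⟩`, for `m ≥ 1`. -/
def N (m : ℕ+) : Subgroup DInf := Subgroup.zpowers ((g₀ * g₁) ^ (m : ℕ))

theorem N_le (m : ℕ+) : N m ≤ Subgroup.zpowers rot :=
  Subgroup.zpowers_le.2 (Subgroup.pow_mem _ (Subgroup.mem_zpowers rot) _)

instance N_normal (m : ℕ+) : (N m).Normal where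
  conj_mem z hz s := by
    rcases conj_eq s z (N_le m hz) with h | h <;> rw [h]
    · exact hz
    · exact (N m).inv_mem hz

theorem N_stable (m : ℕ+) (t : C₂) : ∀ z ∈ N m, t • z ∈ N m := by
  intro z hz
  rcases smul_eq t z (N_le m hz) with h | h <;> rw [h]
  · exact hz
  · exact (N m).inv_mem hz

/-- The induced action of `ℤ/2` on `(ℤ/2 ∗ ℤ/2)/N_m`. -/
instance (m : ℕ+) : MulDistribMulAction C₂ (DInf ⧸ N m) := quotientAction (N m) (N_stable m)

theorem N_exists (m : ℕ+) (z : N m) : ∃ n : ℤ, ((g₀ * g₁) ^ (m : ℕ)) ^ n = (z : DInf) := z.2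

theorem N_injective (m : ℕ+) :
    Function.Injective fun n : ℤ => ((g₀ * g₁) ^ (m : ℕ)) ^ n := by
  intro a b hab
  have h : rot ^ ((m : ℤ) * a) = rot ^ ((m : ℤ) * b) := by
    have hab' : (rot ^ (m : ℕ)) ^ a = (rot ^ (m : ℕ)) ^ b := hab
    simpa only [zpow_mul, zpow_natCast] using hab'
  have hm : (m : ℤ) ≠ 0 := by exact_mod_cast m.ne_zero
  exact mul_left_cancel₀ hm (rot_zpow_injective h)

/-- The exponent `n` of an element `((g₀ g₁)^m)^n` of `N_m`. -/
def expo (m : ℕ+) (z : N m) : ℤ := (N_exists m z).choose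

theorem expo_eq (m : ℕ+) (z : N m) (n : ℤ) (hz : ((g₀ * g₁) ^ (m : ℕ)) ^ n = (z : DInf)) :
    expo m z = n :=
  N_injective m ((N_exists m z).choose_spec.trans hz.symm)

theorem expo_spec (m : ℕ+) (z : N m) : ((g₀ * g₁) ^ (m : ℕ)) ^ expo m z = (z : DInf) :=
  (N_exists m z).choose_spec

variable (k : Type*) [Field k]

/-- The non-trivial character `χ` of `ℤ/2` with values in `{1, -1}`, as an invertible element of
`k^{ℤ/2}`. -/
def χ : (C₂ → k)ˣ where
  val t := if t = 1 then 1 else -1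
  inv t := if t = 1 then 1 else -1
  val_inv := by ext t; by_cases h : t = 1 <;> simp [h]
  inv_val := by ext t; by_cases h : t = 1 <;> simp [h]

theorem χ_inv : (χ k)⁻¹ = χ k := rfl

theorem χ_mul (l h : C₂) : (χ k : C₂ → k) (l * h) = (χ k : C₂ → k) h * (χ k : C₂ → k) l := by
  have key : ∀ t u : C₂, (t = 1 ∧ u = 1 ∧ t * u = 1) ∨ (t ≠ 1 ∧ u = 1 ∧ t * u ≠ 1) ∨
      (t = 1 ∧ u ≠ 1 ∧ t * u ≠ 1) ∨ (t ≠ 1 ∧ u ≠ 1 ∧ t * u = 1) := by decide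
  rcases key l h with ⟨h1, h2, h3⟩ | ⟨h1, h2, h3⟩ | ⟨h1, h2, h3⟩ | ⟨h1, h2, h3⟩ <;>
    simp [χ, h1, h2, h3]

/-- The group morphism `Φ_m : N_m → (k^{ℤ/2})ˣ`, `((g₀ g₁)^m)^n ↦ χ^n`. -/
def Φ (m : ℕ+) : N m →* (C₂ → k)ˣ where
  toFun z := χ k ^ expo m z
  map_one' := by
    rw [expo_eq m 1 0 (by simp), zpow_zero]
  map_mul' y z := by
    rw [expo_eq m (y * z) (expo m y + expo m z)
      (by rw [zpow_add, expo_spec, expo_spec, Subgroup.coe_mul]), zpow_add]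

theorem Φ_apply (m : ℕ+) (z : N m) (n : ℤ) (hz : ((g₀ * g₁) ^ (m : ℕ)) ^ n = (z : DInf)) :
    Φ k m z = χ k ^ n :=
  congrArg (χ k ^ ·) (expo_eq m z n hz)

/-- `Φ_m` is the morphism that sends the generator `(g₀ g₁)^m` to `χ`. -/
theorem Φ_gen (m : ℕ+) : Φ k m ⟨(g₀ * g₁) ^ (m : ℕ), Subgroup.mem_zpowers _⟩ = χ k := by
  rw [Φ_apply k m _ 1 (by simp), zpow_one]

theorem Φ_cases (m : ℕ+) (z : N m) : Φ k m z = 1 ∨ Φ k m z = χ k := by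
  have h2 : χ k * χ k = 1 := by rw [mul_eq_one_iff_eq_inv, χ_inv]
  obtain ⟨n, hn⟩ := N_exists m z
  rw [Φ_apply k m z n hn]
  rcases Int.even_or_odd n with ⟨i, rfl⟩ | ⟨i, rfl⟩
  · left
    rw [← two_mul, zpow_mul, zpow_two, h2, one_zpow]
  · right
    rw [zpow_add, zpow_mul, zpow_two, h2, one_zpow, one_mul, zpow_one]

theorem Φ_inv (m : ℕ+) (z : N m) : Φ k m z⁻¹ = Φ k m z := by
  rw [map_inv]
  rcases Φ_cases k m z with h | h <;> rw [h]
  · exact inv_one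
  · exact χ_inv k

/-- The quotient datum `(ℤ/2, N_m, Φ_m)`. -/
def datum (m : ℕ+) : QuotientDatum k DInf C₂ where
  N := N m
  normal := N_normal m
  stable := N_stable m
  Φ := Φ k m
  Φ_mul z l h := by
    have e : Φ k m ⟨l⁻¹ • (z : DInf), N_stable m l⁻¹ z z.2⟩ = Φ k m z := by
      rcases smul_eq l⁻¹ z (N_le m z.2) with h | h
      · exact congrArg _ (Subtype.ext h)
      · rw [← Φ_inv k m z]
        exact congrArg _ (Subtype.ext h)
    rw [e]
    rcases Φ_cases k m z with h' | h' <;> rw [h']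
    · simp
    · exact χ_mul k l h
  Φ_conj z s := by
    rcases conj_eq s z (N_le m z.2) with h | h
    · exact congrArg _ (Subtype.ext h)
    · rw [← Φ_inv k m z]
      exact congrArg _ (Subtype.ext h)

end DInf

/-- The Hopf algebra `k[ℤ/2 ∗ ℤ/2] ⋊ k^{ℤ/2}`. -/
abbrev HopfDInf (k : Type*) [Field k] : Type _ := SmashCoproduct k DInf C₂

/-- The Hopf algebra `A(m) = k[(ℤ/2 ∗ ℤ/2)/N_m] ⋊ k^{ℤ/2}`. -/
abbrev HopfA (k : Type*) [Field k] (m : ℕ+) : Type _ := SmashCoproduct k (DInf ⧸ DInf.N m) C₂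

/-- The Hopf algebra `B(m) = k[(ℤ/2 ∗ ℤ/2)/N_m] ⋊_{Φ_m} k^{ℤ/2}`. -/
abbrev HopfB (k : Type*) [Field k] (m : ℕ+) : Type _ := (DInf.datum k m).Twisted

/-- The automorphism of the dihedral group that exchanges the reflections `s` and `s r`
(the images of `g₀` and `g₁`). -/
def dihedralFlip (n : ℕ) : DihedralGroup n →* DihedralGroup n where
  toFun
    | .r i => .r (-i)
    | .sr i => .sr (1 - i)
  map_one' := congrArg DihedralGroup.r neg_zero
  map_mul' := by
    rintro (i | i) (j | j)
    · simp only [DihedralGroup.r_mul_r]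
      congr 1
      ring
    · simp only [DihedralGroup.r_mul_sr]
      congr 1
      ring
    · simp only [DihedralGroup.sr_mul_r]
      congr 1
      ring
    · simp only [DihedralGroup.sr_mul_sr]
      congr 1
      ring

/-- The action of `ℤ/2` on the dihedral group by exchange of the two generating reflections. -/
instance (n : ℕ) : MulDistribMulAction C₂ (DihedralGroup n) :=
  involutionAction (dihedralFlip n) (by
    rintro (i | i)
    · exact congrArg DihedralGroup.r (neg_neg i)
    · exact congrArg DihedralGroup.sr (sub_sub_cancel 1 i))

/-- `L` is a non-trivial Hopf algebra quotient of `A`: there is a surjective, non-injective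
morphism of Hopf algebras `A → L`, and `dim L > 1`.  (A bialgebra morphism between Hopf algebras
automatically commutes with the antipodes.) -/
def IsNontrivialHopfQuotient (k A L : Type*) [Field k] [Ring A] [HopfAlgebra k A] [Ring L]
    [HopfAlgebra k L] : Prop :=
  ∃ π : A →ₐc[k] L, Function.Surjective π ∧ ¬ Function.Injective π ∧ 1 < Module.rank k L

end

/-! Let π be a surjective bialgebra morphism from k[D_∞] ⋊ k^{ℤ/2} onto L, and put e = π(1 # δ_1), f
= π(1 # δ_h), two orthogonal idempotents of sum 1.

If f = 0, all the π(r # δ_h) vanish and the π(r # δ_1) form a group of group-like elements that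
spans L. Distinct group-like elements are independent, so L is the group algebra of a quotient of
D_∞; such a quotient is trivial, a D_m, or D_∞ itself (`DInf.quotient_cases`).

If f ≠ 0, let M be the normal subgroup of all r with π(r # δ_1) = e. Comparing coproducts shows that
for r in M the element π(r # δ_h) is a nonzero multiple of f and that h.r is again in M
(`DInf.map_of_gen`). Hence M is 1, D_∞ or some N_m (`DInf.stable_cases`). If M = 1, then π is
injective (`Crossed.injective_of_injective`), which is excluded. If M = D_∞, then L is spanned by e
and f, hence by 1 and the group-like element e - f, as the characteristic is not 2; so L = k[D_1].
If M = N_m, write π((g₀g₁)^m # δ_h) = c f. Conjugation by g₀ inverts (g₀g₁)^m but does not change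
the scalar, so c = 1 or c = -1. Then π factors through the projection onto A(m) or B(m)
respectively, and the injectivity criterion, applied to the induced map, shows that it is an
isomorphism.

Conversely, r # δ_h ↦ δ_{h,1} r and the projections onto A(m) and B(m) realize all the listed
algebras. The former kills 1 # δ_h, and the latter have a finite-dimensional target, so none is
injective. -/

noncomputable section

/-! ### Group-like elements and recognition of group algebras -/

/-- A family of distinct nonzero common eigenvectors `v i` of operators `T ψ`, with eigenvalues
`ψ (v i)`, is linearly independent. -/
theorem linearIndependent_of_forall_dual {k V ι : Type*} [Field k] [AddCommGroup V] [Module k V]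
    {v : ι → V} (hv : Function.Injective v) (h0 : ∀ i, v i ≠ 0)
    (T : Module.Dual k V → V →ₗ[k] V) (hT : ∀ ψ i, T ψ (v i) = ψ (v i) • v i) :
    LinearIndependent k v := by
  classical
  rw [linearIndependent_iff']
  intro s
  induction s using Finset.induction_on with
  | empty => simp
  | insert a s ha ih =>
    intro c hc
    have hs : ∀ i ∈ s, c i = 0 := by
      intro i hi
      have hne : v i - v a ≠ 0 := sub_ne_zero.2 fun e => ha (hv e ▸ hi)
      obtain ⟨ψ, hψ⟩ : ∃ ψ : Module.Dual k V, ψ (v i - v a) ≠ 0 := by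
        by_contra! h
        exact hne ((Module.forall_dual_apply_eq_zero_iff k _).1 h)
      -- Apply `T ψ - ψ (v a)` to the relation: the term of index `a` dies, and the coefficient of
      -- `v i` is multiplied by a nonzero scalar.
      have h1 : ∑ j ∈ insert a s, (c j * (ψ (v j) - ψ (v a))) • v j = 0 := by
        calc _ = T ψ (∑ j ∈ insert a s, c j • v j) - ψ (v a) • ∑ j ∈ insert a s, c j • v j := by
              rw [map_sum, Finset.smul_sum, ← Finset.sum_sub_distrib]
              refine Finset.sum_congr rfl fun j _ => ?_
              rw [map_smul, hT]
              module
          _ = 0 := by rw [hc, map_zero, smul_zero, sub_zero]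
      have h2 : ∑ j ∈ s, (c j * (ψ (v j) - ψ (v a))) • v j = 0 := by
        rwa [Finset.sum_insert ha, sub_self, mul_zero, zero_smul, zero_add] at h1
      have h3 := ih _ h2 i hi
      rw [map_sub] at hψ
      exact (mul_eq_zero.1 h3).resolve_right hψ
    have hca : c a = 0 := by
      rw [Finset.sum_insert ha, Finset.sum_eq_zero fun i hi => by rw [hs i hi, zero_smul],
        add_zero] at hc
      exact (smul_eq_zero.1 hc).resolve_right (h0 a)
    intro i hi
    rcases Finset.mem_insert.1 hi with rfl | hi
    · exact hca
    · exact hs i hi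

/-- A family of distinct nonzero vectors that a linear map `δ : V → V ⊗ V` sends to their squares
is linearly independent. -/
theorem linearIndependent_of_comul {k V ι : Type*} [Field k] [AddCommGroup V] [Module k V]
    {v : ι → V} (hv : Function.Injective v) (h0 : ∀ i, v i ≠ 0) (δ : V →ₗ[k] V ⊗[k] V)
    (hδ : ∀ i, δ (v i) = v i ⊗ₜ v i) : LinearIndependent k v := by
  -- Contracting the first leg of `δ` with `ψ` makes each `v i` an eigenvector of eigenvalue `ψ (v
  -- i)`.
  refine linearIndependent_of_forall_dual hv h0
    (fun ψ => (TensorProduct.lid k V).toLinearMap ∘ₗ ψ.rTensor V ∘ₗ δ) fun ψ i => ?_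
  simp [hδ]

/-- A bialgebra is of dimension `> 1` as soon as the counit kills a nonzero element. -/
theorem one_lt_rank_of_counit_eq_zero {k L : Type*} [Field k] [Ring L] [Bialgebra k L] {v : L}
    (hv : v ≠ 0) (h : Coalgebra.counit (R := k) v = 0) : 1 < Module.rank k L := by
  -- On a line containing `1` the counit is injective, because it takes the value 1 at `1`.
  rw [← not_le, rank_le_one_iff]
  rintro ⟨w, hw⟩
  obtain ⟨r, rfl⟩ := hw v
  obtain ⟨t, ht⟩ := hw 1
  have h1 : t * Coalgebra.counit (R := k) w = 1 := by
    rw [← smul_eq_mul, ← map_smul, ht, Bialgebra.counit_one]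
  rw [map_smul, smul_eq_mul] at h
  rcases mul_eq_zero.1 h with h | h
  · exact hv (by rw [h, zero_smul])
  · rw [h, mul_zero] at h1
    exact zero_ne_one h1

/-- A linear map through which a bialgebra morphism factors after a surjective bialgebra morphism is
a bialgebra morphism. -/
def BialgHom.factor {k A B L : Type*} [Field k] [Ring A] [Bialgebra k A] [Ring B] [Bialgebra k B]
    [Ring L] [Bialgebra k L] (ρ : A →ₐc[k] B) (hρ : Function.Surjective ρ) (π : A →ₐc[k] L)
    (φ : B →ₗ[k] L) (h : ∀ a, φ (ρ a) = π a) : B →ₐc[k] L where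
  __ := φ
  counit_comp := by
    ext b
    obtain ⟨a, rfl⟩ := hρ b
    change Coalgebra.counit (φ (ρ a)) = Coalgebra.counit (ρ a)
    rw [h, CoalgHomClass.counit_comp_apply, CoalgHomClass.counit_comp_apply]
  map_comp_comul := by
    ext b
    obtain ⟨a, rfl⟩ := hρ b
    change TensorProduct.map φ φ (Coalgebra.comul (ρ a)) = Coalgebra.comul (φ (ρ a))
    have hc : φ ∘ₗ (ρ : A →ₗ[k] B) = (π : A →ₗ[k] L) := LinearMap.ext h
    rw [h, ← CoalgHomClass.map_comp_comul_apply π, ← CoalgHomClass.map_comp_comul_apply ρ,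
      ← LinearMap.comp_apply, ← TensorProduct.map_comp]
    exact congrArg (fun f => TensorProduct.map f f _) hc
  map_one' := by
    change φ 1 = 1
    rw [← map_one ρ, h, map_one]
  map_mul' x y := by
    obtain ⟨a, rfl⟩ := hρ x
    obtain ⟨b, rfl⟩ := hρ y
    change φ (ρ a * ρ b) = φ (ρ a) * φ (ρ b)
    rw [← map_mul, h, h, h, map_mul]

/-- A bialgebra spanned by a group of group-like elements is a group algebra. -/
theorem nonempty_bialgEquiv_monoidAlgebra {k L G : Type*} [Field k] [Ring L] [Bialgebra k L]
    [Group G] (u : G →* L) (hu : ∀ g, IsGroupLikeElem k (u g)) (hinj : Function.Injective u)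
    (hspan : Submodule.span k (Set.range u) = ⊤) : Nonempty (L ≃ₐc[k] MonoidAlgebra k G) := by
  let φ : MonoidAlgebra k G →ₐc[k] L := .ofAlgHom (MonoidAlgebra.lift k L G u)
    (by ext g; simp [(hu g).counit_eq_one]) (by ext g; simp [(hu g).comul_eq_tmul_self])
  have hφ : ∀ x : MonoidAlgebra k G, φ x = Finsupp.linearCombination k u x.coeff := fun x => by
    change MonoidAlgebra.lift k L G u x = _
    rw [MonoidAlgebra.lift_apply, Finsupp.linearCombination_apply]
  have hli : LinearIndependent k u := linearIndependent_of_comul hinj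
    (fun g h => by simpa [h] using (hu g).counit_eq_one) Coalgebra.comul
    fun g => (hu g).comul_eq_tmul_self
  refine ⟨(BialgEquiv.ofBijective φ ⟨fun x y hxy => ?_, fun y => ?_⟩).symm⟩
  · rw [hφ, hφ] at hxy
    exact MonoidAlgebra.coeff_injective (hli hxy)
  · have hy : y ∈ Submodule.span k (Set.range u) := hspan ▸ Submodule.mem_top
    rw [← Finsupp.range_linearCombination] at hy
    obtain ⟨c, rfl⟩ := hy
    exact ⟨.ofCoeff c, hφ _⟩

/-! ### Morphisms out of crossed coproducts and the injectivity criterion -/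

namespace Crossed

variable {k Q H : Type*} [Field k] [Group Q] [Group H] [MulDistribMulAction H Q]
variable {D : CocycleDatum k Q H}

theorem span_of : Submodule.span k (Set.range fun p : Q × H => of D p.1 p.2) = ⊤ := by
  refine top_unique fun a _ => ?_
  have := (Finsupp.basisSingleOne (R := k) (ι := Q × H)).span_eq
  exact (this ▸ Submodule.mem_top : (a : (Q × H) →₀ k) ∈ _)

theorem of_injective : Function.Injective fun p : Q × H => of D p.1 p.2 :=
  fun _ _ h => Finsupp.single_left_injective (one_ne_zero (α := k)) h

theorem of_ne_zero (x : Q) (h : H) : of D x h ≠ 0 :=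
  Finsupp.single_ne_zero.2 one_ne_zero

instance [Finite Q] [Finite H] : Module.Finite k (Crossed D) :=
  inferInstanceAs (Module.Finite k ((Q × H) →₀ k))

/-- The antipode identity `s_right` has this value as a factor of a product equal to 1. As a
consequence (x # δ_h)(x⁻¹ # δ_h) is a nonzero multiple of 1 # δ_h. -/
theorem σ_ne_zero (D : CocycleDatum k Q H) (x : Q) (h : H) : D.σ x x⁻¹ h ≠ 0 := fun h0 => by
  have := D.s_right h⁻¹ x
  simp [h0] at this

theorem surjective_of_range {L : Type*} [AddCommGroup L] [Module k L] (π : L →ₗ[k] Crossed D)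
    (hπ : ∀ x h, of D x h ∈ LinearMap.range π) : Function.Surjective π := by
  rw [← LinearMap.range_eq_top, eq_top_iff, ← span_of, Submodule.span_le]
  rintro _ ⟨⟨x, h⟩, rfl⟩
  exact hπ x h

variable [DecidableEq H] [Fintype H]

/-- A bialgebra morphism out of `Crossed D`, from its values on the basis. -/
def bialgHom {L : Type*} [Ring L] [Bialgebra k L] (f : Q → H → L) (h1 : ∑ h, f 1 h = 1)
    (hmul : ∀ x h y g, f x h * f y g = if h = g then D.σ x y h • f (x * y) h else 0)
    (hcounit : ∀ x h, Coalgebra.counit (R := k) (f x h) = if h = 1 then 1 else 0)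
    (hcomul : ∀ x h, Coalgebra.comul (R := k) (f x h) =
      ∑ l : H, f x l⁻¹ ⊗ₜ[k] (D.τ l x (l * h) • f (l • x) (l * h))) : Crossed D →ₐc[k] L where
  __ := lin D f
  counit_comp := hom_ext fun x h => by
    change Coalgebra.counit (lin D f (of D x h)) = Coalgebra.counit (of D x h)
    rw [lin_of, hcounit, counit_of]
  map_comp_comul := hom_ext fun x h => by
    change TensorProduct.map (lin D f) (lin D f) (Coalgebra.comul (of D x h)) =
      Coalgebra.comul (lin D f (of D x h))
    rw [lin_of, hcomul, comul_of, map_sum]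
    simp only [TensorProduct.map_tmul, map_smul, lin_of]
  map_one' := by
    change lin D f 1 = 1
    rw [one_def, map_sum, ← h1]
    simp only [lin_of]
  map_mul' a b := by
    have h2 : (LinearMap.mul k (Crossed D)).compr₂ (lin D f) =
        (LinearMap.mul k L).compl₁₂ (lin D f) (lin D f) := by
      refine hom_ext₂ fun x h y g => ?_
      simp only [LinearMap.compr₂_apply, LinearMap.mul_apply', LinearMap.compl₁₂_apply, lin_of,
        of_mul_of, hmul]
      split_ifs <;> simp
    exact LinearMap.congr_fun (LinearMap.congr_fun h2 a) b

section

variable {L : Type*} [Ring L] [Bialgebra k L] (f : Q → H → L) (h1 : ∑ h, f 1 h = 1)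
    (hmul : ∀ x h y g, f x h * f y g = if h = g then D.σ x y h • f (x * y) h else 0)
    (hcounit : ∀ x h, Coalgebra.counit (R := k) (f x h) = if h = 1 then 1 else 0)
    (hcomul : ∀ x h, Coalgebra.comul (R := k) (f x h) =
      ∑ l : H, f x l⁻¹ ⊗ₜ[k] (D.τ l x (l * h) • f (l • x) (l * h)))

@[simp] theorem bialgHom_of (x : Q) (h : H) :
    bialgHom f h1 hmul hcounit hcomul (of D x h) = f x h :=
  lin_of _ _ _

end

section

variable {Q' : Type*} [Group Q'] [MulDistribMulAction H Q'] {D' : CocycleDatum k Q' H}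
  (f : Q →* Q') (hf : ∀ (l : H) x, f (l • x) = l • f x) (w : Q → H → k)
  (w_one : ∀ h, w 1 h = 1) (w_counit : ∀ x, w x 1 = 1)
  (w_mul : ∀ x y h, w x h * w y h * D'.σ (f x) (f y) h = D.σ x y h * w (x * y) h)
  (w_comul : ∀ l x h, w x h * D'.τ l (f x) (l * h) =
    D.τ l x (l * h) * w x l⁻¹ * w (l • x) (l * h))

/-- The morphism `x # δ_h ↦ f x # w(x) δ_h` defined by an equivariant group morphism `f` and by
functions `w(x)` on `H` that relate the two data. -/
def map : Crossed D →ₐc[k] Crossed D' :=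
  bialgHom (fun x h => w x h • of D' (f x) h)
    (by simp only [w_one, map_one, one_smul, one_def])
    (fun x h y g => by
      rw [smul_mul_smul_comm, of_mul_of]
      by_cases hg : h = g
      · subst hg
        simp only [if_true, smul_smul, w_mul, map_mul]
      · simp [hg])
    (fun x h => by
      rw [map_smul, counit_of]
      by_cases hh : h = 1
      · subst hh
        simp [w_counit]
      · simp [hh])
    (fun x h => by
      rw [map_smul, comul_of, Finset.smul_sum]
      refine Finset.sum_congr rfl fun l _ => ?_
      simp only [hf, TensorProduct.tmul_smul, ← TensorProduct.smul_tmul', smul_smul]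
      congr 1
      rw [w_comul]
      ring)

@[simp] theorem map_of (x : Q) (h : H) :
    map f hf w w_one w_counit w_mul w_comul (of D x h) = w x h • of D' (f x) h :=
  bialgHom_of _ _ _ _ _ _ _

end

theorem mul_of_one (x : Q) (h g : H) :
    of D x h * of D 1 g = if h = g then of D x h else 0 := by
  rw [of_mul_of, mul_one, D.σ_one_right, one_smul]

/-- Selecting the term of index `1` in the coproduct formula. -/
theorem comul_of_mul (x : Q) (h g : H) :
    Coalgebra.comul (R := k) (of D x h) * (of D 1 1 ⊗ₜ of D 1 g) =
      if h = g then of D x 1 ⊗ₜ of D x h else 0 := by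
  rw [comul_of, Finset.sum_mul, Finset.sum_eq_single 1]
  · rw [Algebra.TensorProduct.tmul_mul_tmul, inv_one, one_mul, one_smul, D.τ_one_left, one_smul,
      mul_of_one, mul_of_one, if_pos rfl]
    split_ifs <;> simp
  · intro l _ hl
    rw [Algebra.TensorProduct.tmul_mul_tmul, mul_of_one, if_neg (by simpa using hl),
      TensorProduct.zero_tmul]
  · simp

open Classical in
/-- The coefficient of `x # δ_h`. -/
def coeff (D : CocycleDatum k Q H) (x : Q) (h : H) : Crossed D →ₗ[k] k :=
  lin D fun y g => if y = x ∧ g = h then 1 else 0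

theorem eq_zero_of_coeff {a : Crossed D} (ha : ∀ x h, coeff D x h a = 0) : a = 0 := by
  refine Finsupp.ext (α := Q × H) (M := k) fun p => ?_
  have h1 : coeff D p.1 p.2 = (Finsupp.lapply p : ((Q × H) →₀ k) →ₗ[k] k) := by
    refine hom_ext fun x h => ?_
    classical
    refine (lin_of _ _ _).trans ?_
    refine Eq.trans ?_ (Finsupp.single_apply (a := (x, h)) (a' := p) (b := (1 : k))).symm
    simp only [Prod.ext_iff]
  exact (LinearMap.congr_fun h1 a).symm.trans (ha p.1 p.2)

/-- A bialgebra morphism out of `Crossed D` is injective as soon as it separates the elements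
`x # δ_1` and does not kill the idempotents `1 # δ_h`. -/
theorem injective_of_injective {L : Type*} [Ring L] [Bialgebra k L] (π : Crossed D →ₐc[k] L)
    (h1 : Function.Injective fun x => π (of D x 1)) (h0 : ∀ h, π (of D 1 h) ≠ 0) :
    Function.Injective π := by
  classical
  have hcomul : ∀ x h g, Coalgebra.comul (R := k) (π (of D x h)) *
      (π (of D 1 1) ⊗ₜ π (of D 1 g)) = if h = g then π (of D x 1) ⊗ₜ π (of D x h) else 0 := by
    intro x h g
    let P : Crossed D →ₐ[k] L := π
    have := congrArg (Algebra.TensorProduct.map P P) (comul_of_mul (D := D) x h g)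
    rw [map_mul] at this
    rw [← CoalgHomClass.map_comp_comul_apply π]
    refine this.trans ?_
    split_ifs
    · rfl
    · exact map_zero _
  -- The π(x # δ_1) need not be group-like, but they become so once the coproduct is multiplied by e
  -- ⊗ e, where e = π(1 # δ_1).
  have hli : LinearIndependent k fun x => π (of D x 1) := by
    refine linearIndependent_of_comul h1 (fun x hx => ?_)
      (LinearMap.mulRight k (π (of D 1 1) ⊗ₜ π (of D 1 1)) ∘ₗ Coalgebra.comul)
      fun x => (hcomul x 1 1).trans (if_pos rfl)
    have := CoalgHomClass.counit_comp_apply (R := k) π (of D x 1)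
    rw [hx, map_zero, counit_of, if_pos rfl] at this
    exact zero_ne_one this
  have hne : ∀ x h, π (of D x h) ≠ 0 := by
    intro x h hx
    have h2 : π (of D x h * of D x⁻¹ h) = 0 := by rw [map_mul, hx, zero_mul]
    rw [of_mul_of, if_pos rfl, mul_inv_cancel, map_smul] at h2
    exact (smul_eq_zero.1 h2).elim (σ_ne_zero D x h) (h0 h)
  obtain ⟨G, hG⟩ := LinearMap.exists_leftInverse_of_injective _ (LinearMap.ker_eq_bot.2 hli)
  have hG' : ∀ x, G (π (of D x 1)) = Finsupp.single x 1 := fun x => by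
    simpa using LinearMap.congr_fun hG (Finsupp.single x 1)
  rw [injective_iff_map_eq_zero]
  refine fun a ha => eq_zero_of_coeff fun x g => ?_
  -- `θ` depends only on the image under π: multiplication by π(1 # δ_1) ⊗ π(1 # δ_g) leaves the
  -- terms π(y # δ_1) ⊗ π(y # δ_g), and reading the `x`-coordinate of the first leg through `G`
  -- gives the coefficient of x # δ_g times π(x # δ_g).
  let θ : Crossed D →ₗ[k] L := (TensorProduct.lid k L).toLinearMap ∘ₗ
    (Finsupp.lapply x ∘ₗ G).rTensor L ∘ₗ
    LinearMap.mulRight k (π (of D 1 1) ⊗ₜ π (of D 1 g)) ∘ₗ Coalgebra.comul ∘ₗ (π : _ →ₗ[k] L)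
  have hθ : θ = (coeff D x g).smulRight (π (of D x g)) := by
    refine hom_ext fun y h => ?_
    have : θ (of D y h) = TensorProduct.lid k L ((Finsupp.lapply x ∘ₗ G).rTensor L
        (Coalgebra.comul (R := k) (π (of D y h)) * (π (of D 1 1) ⊗ₜ π (of D 1 g)))) := rfl
    rw [this, hcomul, LinearMap.smulRight_apply, coeff, lin_of]
    by_cases hh : h = g
    · subst hh
      by_cases hy : y = x
      · subst hy
        simp [hG']
      · simp [hG', hy]
    · simp [hh]
  have h3 : θ a = 0 := by
    change TensorProduct.lid k L ((Finsupp.lapply x ∘ₗ G).rTensor L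
        (Coalgebra.comul (R := k) (π a) * (π (of D 1 1) ⊗ₜ π (of D 1 g)))) = 0
    rw [ha]
    simp
  rw [hθ] at h3
  exact (smul_eq_zero.1 h3).resolve_right (hne x g)

end Crossed

/-! ### Quotients and stable normal subgroups of the infinite dihedral group -/

theorem C₂.eq_one_or_gen (t : C₂) : t = 1 ∨ t = C₂.gen := by
  revert t
  decide

theorem C₂.gen_ne_one : C₂.gen ≠ 1 := by decide

theorem C₂.gen_mul_gen : C₂.gen * C₂.gen = 1 := by decide

theorem C₂.gen_inv : C₂.gen⁻¹ = C₂.gen := by decide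

theorem C₂.sum_eq {V : Type*} [AddCommMonoid V] (f : C₂ → V) : ∑ t, f t = f 1 + f C₂.gen := by
  rw [show (Finset.univ : Finset C₂) = {1, C₂.gen} by decide, Finset.sum_pair (by decide)]

namespace DInf

theorem g₀_mul_rot_zpow (n : ℤ) : g₀ * rot ^ n = rot ^ (-n) * g₀ := by
  rw [← mul_inv_eq_iff_eq_mul, ← conj_zpow, g₀_conj_rot, inv_zpow, zpow_neg]

theorem g₁_eq : g₁ = rot⁻¹ * g₀ := by
  rw [rot, mul_inv_rev, g₀_inv, g₁_inv, mul_assoc, g₀_mul_self, mul_one]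

/-- Every element is a rotation or a reflection. -/
theorem eq_rot_zpow (x : DInf) : ∃ n : ℤ, x = rot ^ n ∨ x = rot ^ n * g₀ := by
  have h0 : ∀ x : DInf, (∃ n : ℤ, x = rot ^ n ∨ x = rot ^ n * g₀) →
      ∃ n : ℤ, g₀ * x = rot ^ n ∨ g₀ * x = rot ^ n * g₀ := by
    rintro _ ⟨n, rfl | rfl⟩
    · exact ⟨-n, Or.inr (g₀_mul_rot_zpow n)⟩
    · refine ⟨-n, Or.inl ?_⟩
      rw [← mul_assoc, g₀_mul_rot_zpow, mul_assoc, g₀_mul_self, mul_one]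
  induction x using DInf.induction with
  | h1 => exact ⟨0, Or.inl (zpow_zero _).symm⟩
  | h₀ x hx => exact h0 x hx
  | h₁ x hx =>
    rw [g₁_eq, mul_assoc]
    obtain ⟨n, h | h⟩ := h0 x hx <;> rw [h]
    · exact ⟨-1 + n, Or.inl (by rw [zpow_add, zpow_neg_one])⟩
    · exact ⟨-1 + n, Or.inr (by rw [zpow_add, zpow_neg_one, mul_assoc])⟩

theorem gen_smul_rot_zpow (n : ℤ) : C₂.gen • rot ^ n = rot ^ (-n) := by
  rw [smul_zpow', rot, smul_mul', gen_smul_g₀, gen_smul_g₁, zpow_neg, ← inv_zpow, mul_inv_rev,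
    g₀_inv, g₁_inv]

/-- The exponents of a reflection and of its image add up to the odd number -1. This parity is what
excludes proper stable normal subgroups containing a reflection. -/
theorem gen_smul_refl (n : ℤ) : C₂.gen • (rot ^ n * g₀) = rot ^ (-n - 1) * g₀ := by
  rw [smul_mul', gen_smul_rot_zpow, gen_smul_g₀, g₁_eq, ← mul_assoc, zpow_sub_one]

/-- A normal subgroup without reflections consists of the powers of a rotation. -/
theorem ker_eq_zpowers {G : Type*} [Group G] (f : DInf →* G)
    (hf : ∀ i : ℤ, f (rot ^ i * g₀) ≠ 1) :
    f.ker = Subgroup.zpowers (rot ^ orderOf (f rot)) := by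
  ext x
  rw [MonoidHom.mem_ker]
  constructor
  · intro hx
    obtain ⟨n, rfl | rfl⟩ := eq_rot_zpow x
    · rw [map_zpow, ← orderOf_dvd_iff_zpow_eq_one] at hx
      obtain ⟨c, rfl⟩ := hx
      exact ⟨c, by simp only [zpow_mul, zpow_natCast]⟩
    · exact absurd hx (hf n)
  · rintro ⟨c, rfl⟩
    simp [pow_orderOf_eq_one]

theorem N_eq (m : ℕ+) : N m = Subgroup.zpowers (rot ^ (m : ℕ)) := rfl

theorem toDihedral_g₀ (n : ℕ) : toDihedral n g₀ = .sr 0 := by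
  simp [toDihedral, g₀, C₂.lift, C₂.gen_ne_one]

theorem toDihedral_g₁ (n : ℕ) : toDihedral n g₁ = .sr 1 := by
  simp [toDihedral, g₁, C₂.lift, C₂.gen_ne_one]

theorem toDihedral_rot_zpow (n : ℕ) (i : ℤ) : toDihedral n (rot ^ i) = .r i := by
  rw [map_zpow, toDihedral_rot, DihedralGroup.r_one_zpow]

theorem toDihedral_refl (n : ℕ) (i : ℤ) : toDihedral n (rot ^ i * g₀) = .sr (-i) := by
  rw [map_mul, toDihedral_rot_zpow, toDihedral_g₀, DihedralGroup.r_mul_sr, zero_sub]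

/-- Reflections go to elements `sr _`, never to 1, and the image of `rot` has order `m`, so the
description of kernels without reflections applies. -/
theorem ker_toDihedral (m : ℕ+) : (toDihedral m).ker = N m := by
  rw [ker_eq_zpowers, toDihedral_rot, DihedralGroup.orderOf_r_one, N_eq]
  intro i hi
  rw [toDihedral_refl, DihedralGroup.one_def] at hi
  cases hi

theorem toDihedral_surjective (n : ℕ) : Function.Surjective (toDihedral n) := by
  rintro (i | i)
  · obtain ⟨a, rfl⟩ := ZMod.intCast_surjective i
    exact ⟨_, toDihedral_rot_zpow n a⟩
  · obtain ⟨a, rfl⟩ := ZMod.intCast_surjective i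
    exact ⟨rot ^ (-a) * g₀, by rw [toDihedral_refl]; simp⟩

theorem toDihedral_smul (n : ℕ) (t : C₂) (x : DInf) :
    toDihedral n (t • x) = t • toDihedral n x := by
  rcases C₂.eq_one_or_gen t with rfl | rfl
  · rw [one_smul, one_smul]
  · have h0 : C₂.gen • (DihedralGroup.sr 0 : DihedralGroup n) = .sr 1 :=
      congrArg DihedralGroup.sr (sub_zero 1)
    have h1 : C₂.gen • (DihedralGroup.sr 1 : DihedralGroup n) = .sr 0 :=
      congrArg DihedralGroup.sr (sub_self 1)
    induction x using DInf.induction with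
    | h1 => simp
    | h₀ x hx => rw [smul_mul', map_mul, map_mul, smul_mul', hx, gen_smul_g₀, toDihedral_g₀,
        toDihedral_g₁, h0]
    | h₁ x hx => rw [smul_mul', map_mul, map_mul, smul_mul', hx, gen_smul_g₁, toDihedral_g₀,
        toDihedral_g₁, h1]

/-- The isomorphism between `D_∞ / N_m` and the dihedral group of order `2 m`. -/
def quotientEquiv (m : ℕ+) : DInf ⧸ N m ≃* DihedralGroup m :=
  (QuotientGroup.quotientMulEquivOfEq (ker_toDihedral m).symm).trans
    (QuotientGroup.quotientKerEquivOfSurjective _ (toDihedral_surjective m))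

theorem quotientEquiv_smul (m : ℕ+) (t : C₂) (x : DInf ⧸ N m) :
    quotientEquiv m (t • x) = t • quotientEquiv m x := by
  induction x using QuotientGroup.induction_on with
  | H r => exact toDihedral_smul m t r

instance (m : ℕ+) : Finite (DInf ⧸ N m) := by
  have : NeZero (m : ℕ) := ⟨m.ne_zero⟩
  exact Finite.of_equiv _ (quotientEquiv m).toEquiv.symm

/-- The quotients of the infinite dihedral group. -/
theorem quotient_cases {G : Type*} [Group G] (f : DInf →* G) (hf : Function.Surjective f) :
    Subsingleton G ∨ Function.Injective f ∨ ∃ m : ℕ+, Nonempty (G ≃* DihedralGroup m) := by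
  by_cases hr : ∃ i : ℤ, f (rot ^ i * g₀) = 1
  · obtain ⟨i, hi⟩ := hr
    have h0 : f g₀ = f rot ^ (-i) := by
      rw [map_mul, map_zpow, mul_eq_one_iff_eq_inv'] at hi
      rw [hi, zpow_neg]
    -- Once a reflection is killed, `f g₀` is a power of `f rot` and commutes with it, while
    -- conjugation by `g₀` inverts `rot`. The quotient then has at most two elements.
    have hinv : f rot = (f rot)⁻¹ := by
      have := congrArg f g₀_conj_rot
      rw [map_mul, map_mul, map_inv, map_inv, h0] at this
      rw [← this]
      group
    have hsq : f rot * f rot = 1 := by rw [mul_eq_one_iff_eq_inv]; exact hinv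
    have hpow : ∀ n : ℤ, f rot ^ n = 1 ∨ f rot ^ n = f rot := by
      intro n
      rcases Int.even_or_odd' n with ⟨c, rfl | rfl⟩
      · left; rw [zpow_mul, zpow_two, hsq, one_zpow]
      · right; rw [zpow_add, zpow_mul, zpow_two, hsq, one_zpow, one_mul, zpow_one]
    have hall : ∀ y : G, y = 1 ∨ y = f rot := by
      intro y
      obtain ⟨x, rfl⟩ := hf y
      obtain ⟨n, rfl | rfl⟩ := eq_rot_zpow x
      · rw [map_zpow]; exact hpow n
      · rw [map_mul, map_zpow, h0, ← zpow_add]; exact hpow _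
    by_cases h1 : f rot = 1
    · left
      refine ⟨fun x y => ?_⟩
      rcases hall x with rfl | rfl <;> rcases hall y with rfl | rfl <;> simp [h1]
    -- The group of order 2 counts as the dihedral group with `m = 1`.
    · refine Or.inr (Or.inr ⟨1, ?_⟩)
      have : Fact (Nat.Prime 2) := ⟨Nat.prime_two⟩
      have hG : Nat.card G = 2 := by
        rw [Nat.card_eq_two_iff]
        refine ⟨1, f rot, Ne.symm h1, Set.eq_univ_of_forall fun y => ?_⟩
        simpa using hall y
      have hD : Nat.card (DihedralGroup ((1 : ℕ+) : ℕ)) = 2 := by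
        rw [DihedralGroup.nat_card]; rfl
      exact ⟨mulEquivOfPrimeCardEq hG hD⟩
  · push Not at hr
    have hk := ker_eq_zpowers f hr
    right
    -- `orderOf` is 0 for an element of infinite order; the kernel is then trivial.
    rcases Nat.eq_zero_or_pos (orderOf (f rot)) with h0 | h0
    · left
      rw [h0, pow_zero, Subgroup.zpowers_one_eq_bot] at hk
      exact (MonoidHom.ker_eq_bot_iff f).1 hk
    · right
      let m : ℕ+ := ⟨_, h0⟩
      have hk' : f.ker = N m := hk
      exact ⟨m, ⟨(QuotientGroup.quotientKerEquivOfSurjective f hf).symm.trans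
        ((QuotientGroup.quotientMulEquivOfEq hk').trans (quotientEquiv m))⟩⟩

/-- The normal subgroups stable under the exchange of the generators. -/
theorem stable_cases (M : Subgroup DInf) [M.Normal] (hM : ∀ r ∈ M, C₂.gen • r ∈ M) :
    M = ⊥ ∨ M = ⊤ ∨ ∃ m : ℕ+, M = N m := by
  by_cases hr : ∃ i : ℤ, rot ^ i * g₀ ∈ M
  · right; left
    obtain ⟨i, hi⟩ := hr
    -- A reflection divided by its image under the exchange is an odd power of `rot`; its commutator
    -- with `rot` gives `rot ^ 2`. Together they give `rot`, and then `g₀`.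
    have h1 : rot ^ (2 * i + 1) ∈ M := by
      have := M.mul_mem hi (M.inv_mem (hM _ hi))
      rw [gen_smul_refl] at this
      convert this using 1
      rw [mul_inv_rev, mul_assoc, mul_inv_cancel_left, ← zpow_neg, ← zpow_add]
      congr 1
      ring
    have h2 : rot ^ (2 : ℤ) ∈ M := by
      have := M.mul_mem (Subgroup.Normal.conj_mem ‹_› _ hi rot) (M.inv_mem hi)
      convert this using 1
      have h3 : g₀ * rot⁻¹ = rot * g₀ := by simpa using g₀_mul_rot_zpow (-1)
      calc rot ^ (2 : ℤ) = rot * rot ^ i * (rot * g₀) * (rot ^ i * g₀)⁻¹ := by group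
        _ = _ := by rw [← h3]; group
    have h3 : rot ∈ M := by
      have := M.mul_mem h1 (M.inv_mem (M.zpow_mem h2 i))
      convert this using 1
      group
    have h4 : g₀ ∈ M := (M.mul_mem_cancel_left (M.zpow_mem h3 i)).1 hi
    refine top_unique fun x _ => ?_
    obtain ⟨n, rfl | rfl⟩ := eq_rot_zpow x
    · exact M.zpow_mem h3 n
    · exact M.mul_mem (M.zpow_mem h3 n) h4
  · push Not at hr
    have hk := ker_eq_zpowers (QuotientGroup.mk' M) fun i h => hr i <| by
      rwa [← MonoidHom.mem_ker, QuotientGroup.ker_mk'] at h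
    rw [QuotientGroup.ker_mk'] at hk
    rcases Nat.eq_zero_or_pos (orderOf (QuotientGroup.mk' M rot)) with h0 | h0
    · left
      rwa [h0, pow_zero, Subgroup.zpowers_one_eq_bot] at hk
    · exact Or.inr (Or.inr ⟨⟨_, h0⟩, hk⟩)

end DInf

/-! ### Morphisms from smash coproducts and comparison of images -/

namespace SmashCoproduct

variable {k Γ Γ' H : Type*} [Field k] [Group Γ] [Group Γ'] [Group H] [MulDistribMulAction H Γ]
  [MulDistribMulAction H Γ'] [DecidableEq H] [Fintype H]

/-- The morphism of smash coproducts defined by an equivariant group morphism. -/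
def map (k : Type*) [Field k] (f : Γ →* Γ') (hf : ∀ (l : H) x, f (l • x) = l • f x) :
    SmashCoproduct k Γ H →ₐc[k] SmashCoproduct k Γ' H :=
  Crossed.map f hf (fun _ _ => 1) (by simp) (by simp) (by simp) (by simp)

@[simp] theorem map_of (f : Γ →* Γ') (hf : ∀ (l : H) x, f (l • x) = l • f x) (x : Γ) (h : H) :
    map k f hf (of k x h) = of k (f x) h := by
  rw [map, Crossed.map_of, one_smul]

theorem map_surjective (f : Γ →* Γ') (hf : ∀ (l : H) x, f (l • x) = l • f x)
    (h : Function.Surjective f) : Function.Surjective (map k f hf) := by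
  refine Crossed.surjective_of_range (map k f hf : SmashCoproduct k Γ H →ₗ[k] Crossed (CocycleDatum.trivial k Γ' H)) fun y h' => ?_
  obtain ⟨x, rfl⟩ := h y
  exact ⟨of k x h', map_of f hf x h'⟩

/-- Equivariantly isomorphic groups have isomorphic smash coproducts. -/
theorem nonempty_bialgEquiv (e : Γ ≃* Γ') (he : ∀ (l : H) x, e (l • x) = l • e x) :
    Nonempty (SmashCoproduct k Γ H ≃ₐc[k] SmashCoproduct k Γ' H) := by
  let f : Γ →* Γ' := e
  have hf : ∀ (l : H) x, f (l • x) = l • f x := he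
  refine ⟨BialgEquiv.ofBijective (map k f hf) ⟨?_, map_surjective _ _ e.surjective⟩⟩
  refine Crossed.injective_of_injective _ (fun x y hxy => ?_) fun h => ?_
  · have h1 : of k (f x) (1 : H) = of k (f y) 1 := by
      rw [← map_of f hf, ← map_of f hf]
      exact hxy
    exact e.injective (congrArg Prod.fst (Crossed.of_injective (a₁ := (e x, 1)) (a₂ := (e y, 1)) h1))
  · change map k f hf (of k 1 h) ≠ 0
    rw [map_of]
    exact Crossed.of_ne_zero _ _

/-- A bialgebra morphism `π` out of a smash coproduct that identifies basis elements up to scalars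
in the same way as a projection `ρ : r # δ_h ↦ f r # w(r) δ_h` has the same image as `ρ`. -/
theorem nonempty_bialgEquiv_crossed {L Q : Type*} [Ring L] [Bialgebra k L] [Group Q]
    [MulDistribMulAction H Q] {D : CocycleDatum k Q H} (π : SmashCoproduct k Γ H →ₐc[k] L)
    (hπ : Function.Surjective π) (ρ : SmashCoproduct k Γ H →ₐc[k] Crossed D)
    (hρ : Function.Surjective ρ) (f : Γ →* Q) (s : Q → Γ) (hs : ∀ x, f (s x) = x) (w : Γ → H → k)
    (hw : ∀ r h, ρ (of k r h) = w r h • Crossed.of D (f r) h)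
    (h0 : ∀ h, π (of k 1 h) ≠ 0) (hf : ∀ r : Γ, π (of k r 1) = π (of k 1 1) → f r = 1)
    (hwπ : ∀ r h, π (of k r h) = w r h • π (of k (s (f r)) h)) :
    Nonempty (L ≃ₐc[k] Crossed D) := by
  have hmul : ∀ r s h, π (of k (r * s) h) = π (of k r h) * π (of k s h) := fun r s h => by
    rw [← map_mul, of_mul_of, if_pos rfl]
  -- The candidate inverse is prescribed on representatives; `hwπ` says exactly that F ∘ ρ = π, so
  -- that `F` inherits the bialgebra structure from π.
  let F : Crossed D →ₗ[k] L := Crossed.lin D fun x h => π (of k (s x) h)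
  have hF : ∀ a, F (ρ a) = π a := by
    have : F ∘ₗ (ρ : SmashCoproduct k Γ H →ₗ[k] _) = (π : SmashCoproduct k Γ H →ₗ[k] _) := by
      refine Crossed.hom_ext fun r h => ?_
      change F (ρ (of k r h)) = π (of k r h)
      rw [hw, map_smul, Crossed.lin_of, ← hwπ]
    exact LinearMap.congr_fun this
  let φ := BialgHom.factor ρ hρ π F hF
  have hφ : ∀ x h, φ (Crossed.of _ x h) = π (of k (s x) h) := fun x h => Crossed.lin_of _ _ _
  refine ⟨(BialgEquiv.ofBijective φ ⟨?_, fun y => ?_⟩).symm⟩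
  · refine Crossed.injective_of_injective _ (fun x y hxy => ?_) fun h h1 => ?_
    · simp only [hφ] at hxy
      have h1 : f (s x * (s y)⁻¹) = 1 := hf _ (by rw [hmul, hxy, ← hmul, mul_inv_cancel])
      rw [map_mul, map_inv, hs, hs] at h1
      exact mul_inv_eq_one.1 h1
    -- The section need not satisfy s(1) = 1, but s(1) # δ_h divides 1 # δ_h, so its image cannot
    -- vanish.
    · rw [hφ] at h1
      exact h0 h (by rw [← mul_inv_cancel (s 1), hmul, h1, zero_mul])
  · obtain ⟨a, rfl⟩ := hπ y
    exact ⟨ρ a, hF a⟩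

/-- The morphism `r # δ_h ↦ δ_{h, 1} r` onto the group algebra. -/
def toMonoidAlgebra (k Γ H : Type*) [Field k] [Group Γ] [Group H] [MulDistribMulAction H Γ]
    [DecidableEq H] [Fintype H] : SmashCoproduct k Γ H →ₐc[k] MonoidAlgebra k Γ :=
  Crossed.bialgHom (fun r h => if h = 1 then .single r 1 else 0)
    (by simp [MonoidAlgebra.one_def])
    (fun x h y g => by
      by_cases hg : h = g
      · subst hg
        by_cases h1 : h = 1 <;> simp [h1, MonoidAlgebra.single_mul_single]
      · by_cases h1 : h = 1
        · have : g ≠ 1 := fun e => hg (h1.trans e.symm)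
          simp [hg, this]
        · simp [hg, h1])
    (fun x h => by split_ifs <;> simp)
    (fun x h => by
      rw [Finset.sum_eq_single 1]
      · by_cases h1 : h = 1 <;> simp [h1]
      · intro l _ hl
        simp [hl]
      · simp)

@[simp] theorem toMonoidAlgebra_of (x : Γ) (h : H) :
    toMonoidAlgebra k Γ H (of k x h) = if h = 1 then .single x 1 else 0 :=
  Crossed.bialgHom_of _ _ _ _ _ _ _

theorem toMonoidAlgebra_surjective : Function.Surjective (toMonoidAlgebra k Γ H) := by
  intro y
  induction y using MonoidAlgebra.induction_linear with
  | zero => exact ⟨0, map_zero _⟩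
  | add a b ha hb =>
    obtain ⟨a, rfl⟩ := ha
    obtain ⟨b, rfl⟩ := hb
    exact ⟨a + b, map_add _ _ _⟩
  | single g c =>
    refine ⟨c • of k g 1, ?_⟩
    rw [map_smul, toMonoidAlgebra_of, if_pos rfl, MonoidAlgebra.smul_single, smul_eq_mul, mul_one]

end SmashCoproduct

/-! ### The projection onto a twisted smash coproduct -/

namespace QuotientDatum

variable {k Γ H : Type*} [Field k] [Group Γ] [Group H] [MulDistribMulAction H Γ]
  (E : QuotientDatum k Γ H)

theorem mul_j_inv_mem (r : Γ) : r * (E.j r)⁻¹ ∈ E.N := E.mem_of_mk (by simp)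

variable [DecidableEq H] [Fintype H]

/-- The projection `r # δ_h ↦ [r] # Φ(r j([r])⁻¹) δ_h`. -/
def proj : SmashCoproduct k Γ H →ₐc[k] E.Twisted :=
  Crossed.map (QuotientGroup.mk' E.N) (fun _ _ => rfl)
    (fun r h => E.val (r * (E.j r)⁻¹) (E.mul_j_inv_mem r) h)
    (fun h => E.val_one (by rw [QuotientGroup.mk_one, j_one, inv_one, one_mul]) _ _)
    (fun x => E.val_at_one _ _)
    (fun x y h => by
      change E.val (x * (E.j x)⁻¹) (E.mul_j_inv_mem x) h *
        E.val (y * (E.j y)⁻¹) (E.mul_j_inv_mem y) h *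
        E.val (E.j x * E.j y * (E.j ((x : Γ ⧸ E.N) * y))⁻¹) (E.σ_mem x y) h =
        1 * E.val (x * y * (E.j ((x : Γ ⧸ E.N) * y))⁻¹) (E.mul_j_inv_mem (x * y)) h
      -- By conjugation invariance of Φ, the factor coming from `y` may be conjugated by j(x); the
      -- product of the three arguments then telescopes to x y j(xy)⁻¹.
      have hc := E.normal.conj_mem _ (E.mul_j_inv_mem y) (E.j x)
      rw [← E.val_conj (E.j x) _ (E.mul_j_inv_mem y) hc,
        ← E.val_mul _ _ _ _ (E.N.mul_mem (E.mul_j_inv_mem x) hc),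
        ← E.val_mul _ _ _ _ (E.N.mul_mem (E.N.mul_mem (E.mul_j_inv_mem x) hc) (E.σ_mem _ _)),
        one_mul]
      refine E.val_congr ?_ _ _ _
      group)
    (fun l x h => by
      change E.val (x * (E.j x)⁻¹) (E.mul_j_inv_mem x) h *
        E.val (l • E.j x * (E.j (l • (x : Γ ⧸ E.N)))⁻¹) (E.τ_mem l x) (l * h) =
        1 * E.val (x * (E.j x)⁻¹) (E.mul_j_inv_mem x) l⁻¹ *
          E.val (l • x * (E.j (l • (x : Γ ⧸ E.N)))⁻¹) (E.mul_j_inv_mem (l • x)) (l * h)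
      -- The cocycle law moves the value at `h` to a value at `l * h` of the translate by `l`, where
      -- it telescopes with the factor τ.
      have hl := E.stable l _ (E.mul_j_inv_mem x)
      rw [E.val_cocycle _ (E.mul_j_inv_mem x) l h hl, one_mul, mul_right_comm,
        ← E.val_mul _ _ _ _ (E.N.mul_mem hl (E.τ_mem _ _)), mul_comm]
      congr 1
      refine E.val_congr ?_ _ _ _
      rw [smul_mul', smul_inv']
      group)

theorem proj_of (r : Γ) (h : H) : E.proj (SmashCoproduct.of k r h) =
    E.val (r * (E.j r)⁻¹) (E.mul_j_inv_mem r) h • Crossed.of E.cocycleDatum r h :=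
  Crossed.map_of _ _ _ _ _ _ _ _ _

theorem proj_surjective : Function.Surjective E.proj := by
  refine Crossed.surjective_of_range (E.proj : SmashCoproduct k Γ H →ₗ[k] Crossed E.cocycleDatum) fun y h => ?_
  refine ⟨SmashCoproduct.of k (E.j y) h, (E.proj_of _ _).trans ?_⟩
  rw [E.val_one (by rw [mk_j, mul_inv_cancel]), one_smul, mk_j]

end QuotientDatum

/-! ### The images of k[D_∞] ⋊ k^{ℤ/2} -/

namespace DInf

variable {k L : Type*} [Field k] [Ring L] [Bialgebra k L] (π : HopfDInf k →ₐc[k] L)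

theorem map_of_mul (r s : DInf) (t : C₂) : π (SmashCoproduct.of k (r * s) t) =
    π (SmashCoproduct.of k r t) * π (SmashCoproduct.of k s t) := by
  rw [← map_mul, SmashCoproduct.of_mul_of, if_pos rfl]

theorem map_of_mul_of_ne (r s : DInf) {t u : C₂} (h : t ≠ u) :
    π (SmashCoproduct.of k r t) * π (SmashCoproduct.of k s u) = 0 := by
  rw [← map_mul, SmashCoproduct.of_mul_of, if_neg h, map_zero]

theorem map_of_one_add : π (SmashCoproduct.of k 1 1) + π (SmashCoproduct.of k 1 C₂.gen) = 1 := by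
  rw [← map_add, ← C₂.sum_eq, ← map_one π]
  rfl

theorem counit_map_of (r : DInf) (t : C₂) :
    Coalgebra.counit (R := k) (π (SmashCoproduct.of k r t)) = if t = 1 then 1 else 0 := by
  rw [CoalgHomClass.counit_comp_apply, Crossed.counit_of]

theorem comul_map_of (r : DInf) (t : C₂) :
    Coalgebra.comul (R := k) (π (SmashCoproduct.of k r t)) =
      π (SmashCoproduct.of k r 1) ⊗ₜ π (SmashCoproduct.of k r t) +
      π (SmashCoproduct.of k r C₂.gen) ⊗ₜ π (SmashCoproduct.of k (C₂.gen • r) (C₂.gen * t)) := by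
  rw [← CoalgHomClass.map_comp_comul_apply π, SmashCoproduct.comul_of, C₂.sum_eq, map_add]
  simp only [inv_one, one_smul, one_mul, C₂.gen_inv]
  rfl

theorem eq_top_of_map_of_mem (hπ : Function.Surjective π) (S : Submodule k L)
    (hS : ∀ r t, π (SmashCoproduct.of k r t) ∈ S) : S = ⊤ := by
  refine top_unique fun y _ => ?_
  obtain ⟨a, rfl⟩ := hπ y
  have h : (⊤ : Submodule k (HopfDInf k)) ≤
      S.comap (π : HopfDInf k →ₗ[k] L) := by
    rw [← Crossed.span_of, Submodule.span_le]
    rintro _ ⟨⟨r, t⟩, rfl⟩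
    exact hS r t
  exact h (Submodule.mem_top (x := a))

/-- If `r # δ_1` and `1 # δ_1` have the same image, then `r # δ_h` and `1 # δ_h` have proportional
images, and `h.r # δ_1` has the same image as well. -/
theorem map_of_gen {r : DInf} (h0 : π (SmashCoproduct.of k 1 C₂.gen) ≠ 0)
    (hr : π (SmashCoproduct.of k r 1) = π (SmashCoproduct.of k 1 1)) :
    (∃ c : k, c ≠ 0 ∧ π (SmashCoproduct.of k r C₂.gen) = c • π (SmashCoproduct.of k 1 C₂.gen)) ∧
      π (SmashCoproduct.of k (C₂.gen • r) 1) = π (SmashCoproduct.of k 1 1) := by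
  obtain ⟨ψ, hψ⟩ : ∃ ψ : Module.Dual k L, ψ (π (SmashCoproduct.of k 1 C₂.gen)) ≠ 0 := by
    by_contra! h
    exact h0 ((Module.forall_dual_apply_eq_zero_iff k _).1 h)
  have h1 := comul_map_of π r 1
  rw [hr, comul_map_of, smul_one] at h1
  -- The coproducts of π(r # δ_1) and π(1 # δ_1) share their first term; what remains is F ⊗ F = π(r
  -- # δ_h) ⊗ π(h.r # δ_h). A contraction of the second leg makes π(r # δ_h) proportional to F.
  have h2 := add_left_cancel h1
  have h3 := congrArg (fun z => TensorProduct.rid k L (ψ.lTensor L z)) h2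
  simp only [LinearMap.lTensor_tmul, TensorProduct.rid_tmul, mul_one] at h3
  have h4 := congrArg (fun z => TensorProduct.lid k L (ψ.rTensor L z)) h2
  simp only [LinearMap.rTensor_tmul, TensorProduct.lid_tmul, mul_one] at h4
  set F := π (SmashCoproduct.of k 1 C₂.gen) with hF
  set c := ψ (π (SmashCoproduct.of k (C₂.gen • r) C₂.gen)) with hc
  have hc0 : c ≠ 0 := by
    intro h
    rw [h, zero_smul] at h3
    exact (smul_ne_zero hψ h0) h3
  have h5 : π (SmashCoproduct.of k r C₂.gen) = (c⁻¹ * ψ F) • F := by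
    rw [mul_smul, h3, inv_smul_smul₀ hc0]
  have hd0 : c⁻¹ * ψ F ≠ 0 := mul_ne_zero (inv_ne_zero hc0) hψ
  refine ⟨⟨_, hd0, h5⟩, ?_⟩
  -- The same comparison for δ_h, now that π(r # δ_h) is a multiple of F, leaves F ⊗ π(1 # δ_1) = F
  -- ⊗ π(h.r # δ_1).
  have h6 := comul_map_of π r C₂.gen
  rw [h5, map_smul, hF, comul_map_of, ← hF, hr, C₂.gen_mul_gen, smul_one, smul_add,
    TensorProduct.tmul_smul, ← TensorProduct.smul_tmul'] at h6
  have h7 := smul_right_injective _ hd0 (add_left_cancel h6)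
  have h8 := congrArg (fun z => TensorProduct.lid k L (ψ.rTensor L z)) h7
  simp only [LinearMap.rTensor_tmul, TensorProduct.lid_tmul] at h8
  exact (smul_right_injective _ hψ h8).symm

/-- The elements `r` for which `r # δ_1` and `1 # δ_1` have the same image. -/
def trivialSubgroup : Subgroup DInf where
  carrier := {r | π (SmashCoproduct.of k r 1) = π (SmashCoproduct.of k 1 1)}
  one_mem' := rfl
  mul_mem' {r s} hr hs := by
    change π (SmashCoproduct.of k (r * s) 1) = π (SmashCoproduct.of k 1 1)
    rw [map_of_mul, show π (SmashCoproduct.of k r 1) = _ from hr,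
      show π (SmashCoproduct.of k s 1) = _ from hs, ← map_of_mul, one_mul]
  inv_mem' {r} hr := by
    change π (SmashCoproduct.of k r⁻¹ 1) = π (SmashCoproduct.of k 1 1)
    rw [← mul_one r⁻¹, map_of_mul, ← show π (SmashCoproduct.of k r 1) = _ from hr, ← map_of_mul,
      inv_mul_cancel, hr]

theorem mem_trivialSubgroup {r : DInf} : r ∈ trivialSubgroup π ↔
    π (SmashCoproduct.of k r 1) = π (SmashCoproduct.of k 1 1) := Iff.rfl

instance : (trivialSubgroup π).Normal where
  conj_mem r hr s := by
    rw [mem_trivialSubgroup] at hr ⊢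
    rw [map_of_mul, map_of_mul, hr, ← map_of_mul, ← map_of_mul, mul_one, mul_inv_cancel]

/-- Quotients in which `1 # δ_h` vanishes are group algebras. -/
theorem nonempty_bialgEquiv_of_eq_zero (hπ : Function.Surjective π)
    (h0 : π (SmashCoproduct.of k 1 C₂.gen) = 0) (hL : 1 < Module.rank k L) :
    (∃ m : ℕ+, Nonempty (L ≃ₐc[k] MonoidAlgebra k (DihedralGroup m))) ∨
      Nonempty (L ≃ₐc[k] MonoidAlgebra k DInf) := by
  have h1 : π (SmashCoproduct.of k 1 1) = 1 := by rw [← map_of_one_add π, h0, add_zero]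
  have hgen : ∀ r, π (SmashCoproduct.of k r C₂.gen) = 0 := fun r => by
    rw [← mul_one r, map_of_mul, h0, mul_zero]
  let u : DInf →* L := ⟨⟨fun r => π (SmashCoproduct.of k r 1), h1⟩, fun r s => map_of_mul π r s 1⟩
  have hu : ∀ r, IsGroupLikeElem k (u r) := fun r =>
    ⟨(counit_map_of π r 1).trans (if_pos rfl), by
      refine (comul_map_of π r 1).trans ?_
      rw [hgen, TensorProduct.zero_tmul, add_zero]
      rfl⟩
  have hspan : Submodule.span k (Set.range u) = ⊤ := by
    refine eq_top_of_map_of_mem π hπ _ fun r t => ?_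
    rcases C₂.eq_one_or_gen t with rfl | rfl
    · exact Submodule.subset_span ⟨r, rfl⟩
    · rw [hgen]
      exact Submodule.zero_mem _
  -- The values of `u` are units; dividing by the kernel makes `u` injective without changing its
  -- range.
  let U := QuotientGroup.kerLift u.toHomUnits
  have hU : ∀ r : DInf, (U r : L) = u r := fun r => rfl
  have hequiv : Nonempty (L ≃ₐc[k] MonoidAlgebra k (DInf ⧸ u.toHomUnits.ker)) := by
    refine nonempty_bialgEquiv_monoidAlgebra ((Units.coeHom L).comp U) (fun g => ?_)
      (Units.val_injective.comp (QuotientGroup.kerLift_injective _)) ?_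
    · induction g using QuotientGroup.induction_on with
      | H r => exact hu r
    · rw [← hspan]
      congr 1
      ext y
      constructor
      · rintro ⟨g, rfl⟩
        induction g using QuotientGroup.induction_on with
        | H r => exact ⟨r, rfl⟩
      · rintro ⟨r, rfl⟩
        exact ⟨(r : DInf ⧸ u.toHomUnits.ker), rfl⟩
  obtain ⟨e⟩ := hequiv
  rcases quotient_cases (QuotientGroup.mk' u.toHomUnits.ker) (QuotientGroup.mk'_surjective _) with
    h | h | ⟨m, ⟨f⟩⟩
  -- For a trivial quotient group L would be spanned by 1, against `hL`.
  · exfalso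
    refine not_le.2 hL (rank_le_one_iff.2 ⟨1, fun y => ?_⟩)
    have hy : y ∈ Submodule.span k (Set.range u) := hspan ▸ Submodule.mem_top
    have hr : Set.range u ⊆ {1} := by
      rintro _ ⟨r, rfl⟩
      rw [← hU, Subsingleton.elim (r : DInf ⧸ u.toHomUnits.ker) 1, map_one]
      rfl
    exact Submodule.mem_span_singleton.1 (Submodule.span_mono hr hy)
  · exact Or.inr ⟨e.trans (MonoidAlgebra.domCongrBialgEquiv k k
      (MulEquiv.ofBijective _ ⟨h, QuotientGroup.mk'_surjective _⟩).symm)⟩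
  · exact Or.inl ⟨m, ⟨e.trans (MonoidAlgebra.domCongrBialgEquiv k k f)⟩⟩

/-- Quotients in which all `r # δ_1` have the same image, and `1 # δ_h` does not vanish, are
group algebras of a group of order `2`. -/
theorem nonempty_bialgEquiv_of_eq_top (hk : ringChar k ≠ 2) (hπ : Function.Surjective π)
    (h0 : π (SmashCoproduct.of k 1 C₂.gen) ≠ 0) (hM : trivialSubgroup π = ⊤) :
    Nonempty (L ≃ₐc[k] MonoidAlgebra k (DihedralGroup (1 : ℕ+))) := by
  have h2 : (2 : k) ≠ 0 := Ring.two_ne_zero hk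
  set E := π (SmashCoproduct.of k 1 1) with hE
  set F := π (SmashCoproduct.of k 1 C₂.gen) with hF
  have hEF : E + F = 1 := map_of_one_add π
  have hEE : E * E = E := by rw [hE, ← map_of_mul, one_mul]
  have hFF : F * F = F := by rw [hF, ← map_of_mul, one_mul]
  have hEF0 : E * F = 0 := map_of_mul_of_ne π 1 1 (Ne.symm C₂.gen_ne_one)
  have hFE0 : F * E = 0 := map_of_mul_of_ne π 1 1 C₂.gen_ne_one
  have hsq : (E - F) * (E - F) = 1 := by
    rw [mul_sub, sub_mul, sub_mul, hEE, hFF, hEF0, hFE0, ← hEF]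
    abel
  -- E - F is the image of 1 # χ, with χ the sign character of ℤ/2, hence group-like of square 1.
  let v : Lˣ := ⟨E - F, E - F, hsq, hsq⟩
  let u : C₂ →* L := (Units.coeHom L).comp (C₂.lift v (Units.ext hsq))
  have hu1 : u 1 = 1 := map_one u
  have hug : u C₂.gen = E - F := by
    change ((if C₂.gen = 1 then 1 else v : Lˣ) : L) = E - F
    rw [if_neg C₂.gen_ne_one]
  have hΔE : Coalgebra.comul (R := k) E = E ⊗ₜ E + F ⊗ₜ F := by
    rw [hE, comul_map_of, smul_one, mul_one]
  have hΔF : Coalgebra.comul (R := k) F = E ⊗ₜ F + F ⊗ₜ E := by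
    rw [hF, comul_map_of, smul_one, C₂.gen_mul_gen]
  have hεE : Coalgebra.counit (R := k) E = 1 := (counit_map_of π 1 1).trans (if_pos rfl)
  have hεF : Coalgebra.counit (R := k) F = 0 :=
    (counit_map_of π 1 _).trans (if_neg C₂.gen_ne_one)
  have hequiv : Nonempty (L ≃ₐc[k] MonoidAlgebra k C₂) := by
    refine nonempty_bialgEquiv_monoidAlgebra u (fun t => ?_) ?_ ?_
    · rcases C₂.eq_one_or_gen t with rfl | rfl
      · rw [hu1]
        exact .one
      · rw [hug]
        refine ⟨by rw [map_sub, hεE, hεF, sub_zero], ?_⟩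
        rw [map_sub, hΔE, hΔF, TensorProduct.sub_tmul, TensorProduct.tmul_sub,
          TensorProduct.tmul_sub]
        abel
    · rw [injective_iff_map_eq_one]
      intro t ht
      rcases C₂.eq_one_or_gen t with rfl | rfl
      · rfl
      · exfalso
        rw [hug, ← hEF, sub_eq_add_neg] at ht
        -- E - F = 1 = E + F would give 2F = 0; the characteristic also enters below, to recover E
        -- from 1 and E - F.
        have h3 : (2 : k) • F = 0 := by
          rw [two_smul]
          nth_rewrite 1 [← add_left_cancel ht]
          exact neg_add_cancel F
        exact smul_ne_zero h2 h0 h3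
    · have m1 : (1 : L) ∈ Submodule.span k (Set.range u) := Submodule.subset_span ⟨1, hu1⟩
      have mg : E - F ∈ Submodule.span k (Set.range u) := Submodule.subset_span ⟨_, hug⟩
      have mE : E ∈ Submodule.span k (Set.range u) := by
        have h3 : E = (2 : k)⁻¹ • (1 + (E - F)) := by
          rw [eq_inv_smul_iff₀ h2, two_smul, ← hEF]
          abel
        rw [h3]
        exact Submodule.smul_mem _ _ (Submodule.add_mem _ m1 mg)
      have mF : F ∈ Submodule.span k (Set.range u) := by
        rw [eq_sub_of_add_eq' hEF]
        exact Submodule.sub_mem _ m1 mE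
      refine eq_top_of_map_of_mem π hπ _ fun r t => ?_
      have hr : π (SmashCoproduct.of k r 1) = E :=
        (mem_trivialSubgroup π).1 (hM ▸ Subgroup.mem_top r)
      rcases C₂.eq_one_or_gen t with rfl | rfl
      · rwa [hr]
      · obtain ⟨⟨c, -, hc⟩, -⟩ := map_of_gen π h0 hr
        rw [hc]
        exact Submodule.smul_mem _ _ mF
  obtain ⟨e⟩ := hequiv
  have : Fact (Nat.Prime 2) := ⟨Nat.prime_two⟩
  have hC : Nat.card C₂ = 2 := by simp
  have hD : Nat.card (DihedralGroup ((1 : ℕ+) : ℕ)) = 2 := by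
    rw [DihedralGroup.nat_card]; rfl
  exact ⟨e.trans (MonoidAlgebra.domCongrBialgEquiv k k (mulEquivOfPrimeCardEq hC hD))⟩

/-- Since r ↦ π(r # δ_h) is multiplicative, the scalar attached to a generator of a cyclic group
determines those of all its elements. -/
theorem map_of_zpow {z : DInf} {c : k} (hc : c ≠ 0)
    (hz : π (SmashCoproduct.of k z C₂.gen) = c • π (SmashCoproduct.of k 1 C₂.gen)) (n : ℤ) :
    π (SmashCoproduct.of k (z ^ n) C₂.gen) = c ^ n • π (SmashCoproduct.of k 1 C₂.gen) := by
  induction n using Int.induction_on with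
  | zero => simp
  | succ i ih =>
    rw [zpow_add_one, map_of_mul, ih, hz, smul_mul_smul_comm, ← map_of_mul, mul_one,
      zpow_add_one₀ hc]
  | pred i ih =>
    have h1 : π (SmashCoproduct.of k z⁻¹ C₂.gen) = c⁻¹ • π (SmashCoproduct.of k 1 C₂.gen) := by
      rw [eq_inv_smul_iff₀ hc, ← inv_mul_cancel z, map_of_mul, hz, mul_smul_comm, ← map_of_mul,
        mul_one]
    rw [zpow_sub_one, map_of_mul, ih, h1, smul_mul_smul_comm, ← map_of_mul, mul_one,
      zpow_sub_one₀ hc]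

theorem datum_val_one (m : ℕ+) {n : DInf} (hn : n ∈ (datum k m).N) :
    (datum k m).val n hn 1 = 1 := (datum k m).val_at_one n hn

/-- Evaluation at the generator of ℤ/2 is a group morphism to kˣ and sends χ to -1. This is the
scalar of `map_of_zpow` for c = -1. -/
theorem datum_val_gen (m : ℕ+) (i : ℤ) {n : DInf} (h : (rot ^ (m : ℕ)) ^ i = n)
    (hn : n ∈ (datum k m).N) : (datum k m).val n hn C₂.gen = (-1) ^ i := by
  have h1 : Φ k m ⟨n, hn⟩ = χ k ^ i := Φ_apply k m ⟨n, hn⟩ i h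
  have h2 : Units.map (Pi.evalMonoidHom (fun _ : C₂ => k) C₂.gen) (χ k) = -1 := by
    ext
    change (if C₂.gen = 1 then 1 else -1 : k) = _
    rw [if_neg C₂.gen_ne_one]
    simp
  have h3 : (datum k m).val n hn C₂.gen =
      (Units.map (Pi.evalMonoidHom (fun _ : C₂ => k) C₂.gen) (Φ k m ⟨n, hn⟩) : kˣ) := rfl
  rw [h3, h1, map_zpow, h2, Units.val_zpow_eq_zpow_val]
  simp

theorem mk'_smul (m : ℕ+) (l : C₂) (x : DInf) :
    QuotientGroup.mk' (N m) (l • x) = l • QuotientGroup.mk' (N m) x := rfl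

/-- Quotients attached to the subgroup `N_m`. -/
theorem nonempty_bialgEquiv_of_eq_N (hπ : Function.Surjective π)
    (h0 : π (SmashCoproduct.of k 1 C₂.gen) ≠ 0) (m : ℕ+) (hM : trivialSubgroup π = N m) :
    Nonempty (L ≃ₐc[k] HopfA k m) ∨ Nonempty (L ≃ₐc[k] HopfB k m) := by
  set F := π (SmashCoproduct.of k 1 C₂.gen) with hF
  have h1 : π (SmashCoproduct.of k 1 1) ≠ 0 := fun h => by
    have := counit_map_of π 1 1
    rw [h, map_zero, if_pos rfl] at this
    exact zero_ne_one this
  have hne : ∀ t, π (SmashCoproduct.of k 1 t) ≠ 0 := fun t => by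
    rcases C₂.eq_one_or_gen t with rfl | rfl
    · exact h1
    · exact h0
  have hN : ∀ r : DInf, π (SmashCoproduct.of k r 1) = π (SmashCoproduct.of k 1 1) ↔ r ∈ N m :=
    fun r => by rw [← hM, mem_trivialSubgroup]
  set z := rot ^ (m : ℕ) with hzdef
  have hzN : z ∈ N m := Subgroup.mem_zpowers _
  obtain ⟨⟨c, hc0, hc⟩, -⟩ := map_of_gen π h0 ((hN z).2 hzN)
  have hzpow := map_of_zpow π hc0 hc
  have hinv : g₀ * z * g₀⁻¹ = z ^ (-1 : ℤ) := by
    rw [hzdef, ← conj_pow, g₀_conj_rot, inv_pow, zpow_neg_one]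
  -- Conjugating z # δ_h by g₀ # δ_h keeps the scalar `c`, but replaces `z` by its inverse, whose
  -- scalar is c⁻¹.
  have hcc : c = c⁻¹ := by
    have h2 := hzpow (-1)
    rw [← hinv, map_of_mul, map_of_mul, hc, mul_smul_comm, smul_mul_assoc, ← map_of_mul,
      ← map_of_mul, mul_one, mul_inv_cancel, zpow_neg_one] at h2
    exact smul_left_injective k h0 h2
  have hsq : c * c = 1 := by
    nth_rewrite 2 [hcc]
    exact mul_inv_cancel₀ hc0
  have hmk : ∀ r : DInf, π (SmashCoproduct.of k r 1) = π (SmashCoproduct.of k 1 1) →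
      QuotientGroup.mk' (N m) r = 1 := fun r hr => (QuotientGroup.eq_one_iff r).2 ((hN r).1 hr)
  -- The scalar 1 gives the untwisted quotient A(m), the scalar -1 the quotient B(m) twisted by Φ_m.
  rcases mul_self_eq_one_iff.1 hsq with rfl | rfl
  · left
    have hn : ∀ n ∈ N m, ∀ t, π (SmashCoproduct.of k n t) = π (SmashCoproduct.of k 1 t) := by
      intro n hn t
      rcases C₂.eq_one_or_gen t with rfl | rfl
      · exact (hN n).2 hn
      · obtain ⟨i, rfl⟩ := hn
        exact (hzpow i).trans (by rw [one_zpow, one_smul])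
    refine SmashCoproduct.nonempty_bialgEquiv_crossed π hπ
      (SmashCoproduct.map k _ (mk'_smul m))
      (SmashCoproduct.map_surjective _ _ (QuotientGroup.mk'_surjective _))
      (QuotientGroup.mk' (N m)) Quotient.out (fun x => Quotient.out_eq' x) (fun _ _ => 1)
      (fun r t => by rw [SmashCoproduct.map_of, one_smul]) hne hmk fun r t => ?_
    rw [one_smul]
    set s : DInf := Quotient.out (QuotientGroup.mk' (N m) r)
    have hs : r * s⁻¹ ∈ N m := by
      rw [← QuotientGroup.eq_one_iff, QuotientGroup.mk_mul, QuotientGroup.mk_inv,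
        show ((s : DInf) : DInf ⧸ N m) = r from Quotient.out_eq' _, mul_inv_cancel]
    rw [← inv_mul_cancel_right r s, map_of_mul, hn _ hs, ← map_of_mul, one_mul]
  · right
    have hn : ∀ n (hn : n ∈ (datum k m).N), ∀ t, π (SmashCoproduct.of k n t) =
        (datum k m).val n hn t • π (SmashCoproduct.of k 1 t) := by
      intro n hn t
      rcases C₂.eq_one_or_gen t with rfl | rfl
      · rw [datum_val_one, one_smul]
        exact (hN n).2 hn
      · obtain ⟨i, hi⟩ := id hn
        rw [datum_val_gen m i hi hn]
        exact hi ▸ hzpow i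
    refine SmashCoproduct.nonempty_bialgEquiv_crossed π hπ (datum k m).proj
      (datum k m).proj_surjective (QuotientGroup.mk' (N m)) (datum k m).j (datum k m).mk_j _
      (datum k m).proj_of hne hmk fun r t => ?_
    have e : r = r * ((datum k m).j r)⁻¹ * (datum k m).j r := by group
    conv_lhs => rw [e]
    rw [map_of_mul, hn _ ((datum k m).mul_j_inv_mem r), smul_mul_assoc, ← map_of_mul, one_mul]
    rfl

/-- The classification of the quotients. -/
theorem quotient_classification (hk : ringChar k ≠ 2) (hπ : Function.Surjective π)
    (hinj : ¬ Function.Injective π) (hL : 1 < Module.rank k L) :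
    (∃ m : ℕ+, Nonempty (L ≃ₐc[k] MonoidAlgebra k (DihedralGroup m))) ∨
      Nonempty (L ≃ₐc[k] MonoidAlgebra k DInf) ∨
      (∃ m : ℕ+, Nonempty (L ≃ₐc[k] HopfA k m)) ∨ (∃ m : ℕ+, Nonempty (L ≃ₐc[k] HopfB k m)) := by
  by_cases h0 : π (SmashCoproduct.of k 1 C₂.gen) = 0
  · rcases nonempty_bialgEquiv_of_eq_zero π hπ h0 hL with h | h
    · exact Or.inl h
    · exact Or.inr (Or.inl h)
  -- The second half of `map_of_gen` is the stability of `trivialSubgroup π` under the exchange.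
  rcases stable_cases (trivialSubgroup π) fun r hr => (map_of_gen π h0 hr).2 with h | h | ⟨m, h⟩
  · refine absurd (Crossed.injective_of_injective π (fun r s hrs => ?_) fun t ht => ?_) hinj
    · have h1 : r * s⁻¹ ∈ trivialSubgroup π := by
        have hrs' : π (SmashCoproduct.of k r 1) = π (SmashCoproduct.of k s 1) := hrs
        rw [mem_trivialSubgroup, map_of_mul, hrs', ← map_of_mul, mul_inv_cancel]
      rw [h, Subgroup.mem_bot] at h1
      exact mul_inv_eq_one.1 h1
    · rcases C₂.eq_one_or_gen t with rfl | rfl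
      · have h1 := counit_map_of π 1 1
        rw [show π (SmashCoproduct.of k 1 1) = 0 from ht, map_zero, if_pos rfl] at h1
        exact zero_ne_one h1
      · exact h0 ht
  · exact Or.inl ⟨1, nonempty_bialgEquiv_of_eq_top π hk hπ h0 h⟩
  · rcases nonempty_bialgEquiv_of_eq_N π hπ h0 m h with h | h
    · exact Or.inr (Or.inr (Or.inl ⟨m, h⟩))
    · exact Or.inr (Or.inr (Or.inr ⟨m, h⟩))

/-! ### Dimensions, and realization of the listed algebras -/

theorem not_finite_monoidAlgebra : ¬ Module.Finite k (MonoidAlgebra k DInf) := fun h => by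
  have : Module.Finite k (DInf →₀ k) := Module.Finite.equiv (MonoidAlgebra.coeffLinearEquiv k)
  have h1 : Finite DInf := Module.Finite.finite_basis (Finsupp.basisSingleOne (R := k) (ι := DInf))
  exact not_finite_iff_infinite.2 (Infinite.of_injective _ rot_zpow_injective) h1

/-- It surjects onto the infinite-dimensional k[D_∞]. Hence no map to a finite-dimensional algebra
is injective. -/
theorem not_finite_hopfDInf : ¬ Module.Finite k (HopfDInf k) := fun _ =>
  not_finite_monoidAlgebra (k := k) (Module.Finite.of_surjective
    (SmashCoproduct.toMonoidAlgebra k DInf C₂ : HopfDInf k →ₗ[k] MonoidAlgebra k DInf)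
    SmashCoproduct.toMonoidAlgebra_surjective)

end DInf

theorem BialgEquiv.module_finite {k L L' : Type*} [Field k] [Ring L] [Bialgebra k L] [Ring L']
    [Bialgebra k L'] [Module.Finite k L'] (e : L ≃ₐc[k] L') : Module.Finite k L :=
  Module.Finite.equiv (e.symm : L' ≃ₗ[k] L)

theorem IsNontrivialHopfQuotient.of_bialgEquiv {k A L L' : Type*} [Field k] [Ring A]
    [HopfAlgebra k A] [Ring L] [HopfAlgebra k L] [Ring L'] [HopfAlgebra k L'] (e : L ≃ₐc[k] L')
    (ρ : A →ₐc[k] L') (hρ : Function.Surjective ρ) (hinj : ¬ Function.Injective ρ) {v : L'}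
    (hv : v ≠ 0) (hv0 : Coalgebra.counit (R := k) v = 0) : IsNontrivialHopfQuotient k A L := by
  refine ⟨(e.symm : L' →ₐc[k] L).comp ρ, e.symm.surjective.comp hρ, fun h => ?_, ?_⟩
  · exact hinj (Function.Injective.of_comp h)
  · refine one_lt_rank_of_counit_eq_zero (v := e.symm v) ?_ ?_
    · exact fun h => hv (e.symm.injective (h.trans (map_zero e.symm).symm))
    · rw [CoalgHomClass.counit_comp_apply, hv0]

namespace DInf

variable {k L : Type*} [Field k] [Ring L] [HopfAlgebra k L]

/-- Group algebras of nontrivial quotients of the infinite dihedral group are nontrivial quotients. -/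
theorem isNontrivialHopfQuotient_monoidAlgebra {G : Type*} [Group G] [Nontrivial G] (f : DInf →* G)
    (hf : Function.Surjective f) (e : L ≃ₐc[k] MonoidAlgebra k G) :
    IsNontrivialHopfQuotient k (HopfDInf k) L := by
  obtain ⟨g, hg⟩ := exists_ne (1 : G)
  refine .of_bialgEquiv e
    ((MonoidAlgebra.mapDomainBialgHom k f).comp (SmashCoproduct.toMonoidAlgebra k DInf C₂))
    (Function.Surjective.comp (g := MonoidAlgebra.mapDomainBialgHom k f) (fun y => ?_)
      (SmashCoproduct.toMonoidAlgebra_surjective (k := k) (Γ := DInf) (H := C₂))) (fun h => ?_)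
    (v := .single g 1 - .single 1 1) ?_ ?_
  · induction y using MonoidAlgebra.induction_linear with
    | zero => exact ⟨0, map_zero _⟩
    | add a b ha hb =>
      obtain ⟨a, rfl⟩ := ha
      obtain ⟨b, rfl⟩ := hb
      exact ⟨a + b, map_add _ _ _⟩
    | single g c =>
      obtain ⟨x, rfl⟩ := hf g
      exact ⟨.single x c, MonoidAlgebra.mapDomainBialgHom_single _ _ _⟩
  -- The map kills 1 # δ_h, so it is not injective even when `f` is.
  · refine Crossed.of_ne_zero (D := CocycleDatum.trivial k DInf C₂) 1 C₂.gen (h ?_)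
    rw [map_zero, BialgHom.coe_comp, Function.comp_apply, SmashCoproduct.toMonoidAlgebra_of,
      if_neg C₂.gen_ne_one, map_zero]
  · rw [sub_ne_zero]
    exact fun h => hg (MonoidAlgebra.single_left_injective one_ne_zero h)
  · simp

/-- Finite-dimensional crossed coproducts onto which the smash coproduct maps are nontrivial
quotients. -/
theorem isNontrivialHopfQuotient_crossed {Q : Type*} [Group Q] [Finite Q] [MulDistribMulAction C₂ Q]
    {D : CocycleDatum k Q C₂} (ρ : HopfDInf k →ₐc[k] Crossed D) (hρ : Function.Surjective ρ)
    (e : L ≃ₐc[k] Crossed D) : IsNontrivialHopfQuotient k (HopfDInf k) L :=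
  .of_bialgEquiv e ρ hρ
    (fun h => not_finite_hopfDInf (k := k)
      (Module.Finite.of_injective (ρ : HopfDInf k →ₗ[k] Crossed D) h))
    -- The nonzero element 1 # δ_h has counit 0, so the dimension exceeds 1.
    (Crossed.of_ne_zero 1 C₂.gen) ((Crossed.counit_of _ _).trans (if_neg C₂.gen_ne_one))

end DInf

end

/-! ### Assembly of the proposition -/

theorem proposition3p1 (k : Type*) [Field k] (hk : ringChar k ≠ 2) :
    (∀ (L : Type*) [Ring L] [HopfAlgebra k L],
      IsNontrivialHopfQuotient k (HopfDInf k) L ↔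
        (∃ m : ℕ+, Nonempty (L ≃ₐc[k] MonoidAlgebra k (DihedralGroup m))) ∨
        Nonempty (L ≃ₐc[k] MonoidAlgebra k DInf) ∨
        (∃ m : ℕ+, Nonempty (L ≃ₐc[k] HopfA k m)) ∨
        (∃ m : ℕ+, Nonempty (L ≃ₐc[k] HopfB k m))) ∧
    (∀ m : ℕ+, Nonempty (HopfA k m ≃ₐc[k] SmashCoproduct k (DihedralGroup m) C₂)) ∧
    (∀ (L : Type*) [Ring L] [HopfAlgebra k L],
      (IsNontrivialHopfQuotient k (HopfDInf k) L ∧ ¬ Module.Finite k L) ↔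
        Nonempty (L ≃ₐc[k] MonoidAlgebra k DInf)) := by
  -- Needed for k[D_∞] to have dimension greater than 1.
  have : Nontrivial DInf := DInf.rot_zpow_injective.nontrivial
  refine ⟨fun L _ _ => ⟨?_, ?_⟩, fun m => ?_, fun L _ _ => ⟨?_, ?_⟩⟩
  · rintro ⟨π, hπ, hinj, hL⟩
    exact DInf.quotient_classification π hk hπ hinj hL
  · rintro (⟨m, ⟨e⟩⟩ | ⟨⟨e⟩⟩ | ⟨m, ⟨e⟩⟩ | ⟨m, ⟨e⟩⟩)
    · exact DInf.isNontrivialHopfQuotient_monoidAlgebra _ (DInf.toDihedral_surjective m) e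
    · exact DInf.isNontrivialHopfQuotient_monoidAlgebra (MonoidHom.id DInf)
        Function.surjective_id e
    · exact DInf.isNontrivialHopfQuotient_crossed
        (SmashCoproduct.map k _ (DInf.mk'_smul m))
        (SmashCoproduct.map_surjective _ _ (QuotientGroup.mk'_surjective _)) e
    · have : Finite (DInf ⧸ (DInf.datum k m).N) := inferInstanceAs (Finite (DInf ⧸ DInf.N m))
      exact DInf.isNontrivialHopfQuotient_crossed _ (DInf.datum k m).proj_surjective e
  · exact SmashCoproduct.nonempty_bialgEquiv (DInf.quotientEquiv m) (DInf.quotientEquiv_smul m)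
  · rintro ⟨⟨π, hπ, hinj, hL⟩, hfin⟩
    rcases DInf.quotient_classification π hk hπ hinj hL with
      ⟨m, ⟨e⟩⟩ | h | ⟨m, ⟨e⟩⟩ | ⟨m, ⟨e⟩⟩
    · have : NeZero (m : ℕ) := ⟨m.ne_zero⟩
      exact absurd e.module_finite hfin
    · exact h
    · exact absurd e.module_finite hfin
    · have : Finite (DInf ⧸ (DInf.datum k m).N) := inferInstanceAs (Finite (DInf ⧸ DInf.N m))
      exact absurd e.module_finite hfin
  · rintro ⟨e⟩
    exact ⟨DInf.isNontrivialHopfQuotient_monoidAlgebra (MonoidHom.id DInf)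
      Function.surjective_id e, fun h => DInf.not_finite_monoidAlgebra (k := k)
        (Module.Finite.equiv (e : L ≃ₗ[k] _))⟩
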